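/- Let $\mathcal{A}=(A,E)$ be a computable equivalence structure, that is, $A\subseteq\omega$ is a computable set and $E$ is a computable equivalence relation on $A$. Embeddings between equivalence structures are injective maps that preserve both equivalence and non-equivalence, and $\mathcal{B}\approx\mathcal{A}$ means that each of $\mathcal{A},\mathcal{B}$ embeds in the other. Assume that the degree of bi-embeddable categoricity of $\mathcal{A}$ is $\mathbf{0}'$, that is, $\mathbf{0}'$ is the least Turing degree that computes, for any two computable equivalence structures $\mathcal{B},\mathcal{C}$ bi-embeddable with $\mathcal{A}$, an embedding of $\mathcal{B}$ in $\mathcal{C}$. Let $(\varphi_e)_{e\in\omega}$ be the standard enumeration of the partial computable functions, and let $I_{\mathcal{A}}$ be the set of all $e$ such that $\varphi_e$, read as a binary function, is the total $\{0,1\}$-valued characteristic function of an equivalence relation $E_e$ on $\omega$ with $\mathcal{C}_e=(\omega,E_e)\approx\mathcal{A}$. Then the following holds. 1. If $\mathcal{A}$ has no infinite equivalence classes, then $I_{\mathcal{A}}$ is $\Pi^0_3$-complete. 2. If $\mathcal{A}$ has exactly $k$ infinite equivalence classes for some $0<k<\omega$, then $I_{\mathcal{A}}$ is $D^0_3$-complete,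 where a set is $D^0_3$ if it is the difference of two $\Sigma^0_3$ sets. Here a set is complete for a class if it belongs to the class and every set in the class is many-one reducible to it. -/

import Mathlib

/-! ### Arithmetical hierarchy and many-one completeness for sets of natural numbers -/

/-- `IsSigma n S`: the set `S ⊆ ω` is `Σ⁰ₙ`. A set is `Σ⁰₀` if it is computable, and `Σ⁰ₙ₊₁` if it
is the projection of (the code of) a binary `Π⁰ₙ` relation, that is, of the complement of a
`Σ⁰ₙ` set. -/
def IsSigma : ℕ → Set ℕ → Prop
  | 0, S => ComputablePred fun x => x ∈ S
  | n + 1, S => ∃ R : Set ℕ, IsSigma n Rᶜ ∧ ∀ x, x ∈ S ↔ ∃ y, Nat.pair x y ∈ R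

/-- `S ⊆ ω` is `Π⁰ₙ`: its complement is `Σ⁰ₙ`. -/
def IsPi (n : ℕ) (S : Set ℕ) : Prop := IsSigma n Sᶜ

/-- `S ⊆ ω` is `D⁰ₙ`: it is the difference of two `Σ⁰ₙ` sets. -/
def IsDSigma (n : ℕ) (S : Set ℕ) : Prop :=
  ∃ X Y : Set ℕ, IsSigma n X ∧ IsSigma n Y ∧ S = X \ Y

/-- `S` is `Γ`-complete: it lies in `Γ`, and every set in `Γ` is many-one reducible to it. -/
def IsCompleteFor (Γ : Set ℕ → Prop) (S : Set ℕ) : Prop :=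
  Γ S ∧ ∀ X : Set ℕ, Γ X → ManyOneReducible (fun x => x ∈ X) (fun x => x ∈ S)

/-! ### Turing degrees -/

/-- The `e`-th partial computable function `φ_e`. -/
def phi (e : ℕ) : ℕ →. ℕ := (Denumerable.ofNat Nat.Partrec.Code e).eval

open Classical in
/-- The characteristic function of the halting set `∅' = {e : φ_e(e)↓}`, representing the Turing
degree `0'`. -/
noncomputable def zeroJump (e : ℕ) : ℕ := if (phi e e).Dom then 1 else 0

/-! ### Equivalence structures -/

/-- An equivalence structure `(A, E)`: a universe `A ⊆ ω` with an equivalence relation `E` on `A`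
(given as a set of pairs of elements of `A`). -/
structure EquivStruct where
  carrier : Set ℕ
  rel : ℕ → ℕ → Prop
  mem_of_rel : ∀ {x y}, rel x y → x ∈ carrier ∧ y ∈ carrier
  refl : ∀ {x}, x ∈ carrier → rel x x
  symm : ∀ {x y}, rel x y → rel y x
  trans : ∀ {x y z}, rel x y → rel y z → rel x z

namespace EquivStruct

/-- The structure is computable: its universe and its equivalence relation are computable. -/
def IsComputable (A : EquivStruct) : Prop :=
  (ComputablePred fun x : ℕ => x ∈ A.carrier) ∧ ComputablePred fun p : ℕ × ℕ => A.rel p.1 p.2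

/-- (The restriction to the universe of `A` of) `f` is an embedding of `A` in `B`. -/
def IsEmbedding (A B : EquivStruct) (f : ℕ → ℕ) : Prop :=
  Set.MapsTo f A.carrier B.carrier ∧ Set.InjOn f A.carrier ∧
    ∀ x ∈ A.carrier, ∀ y ∈ A.carrier, A.rel x y ↔ B.rel (f x) (f y)

/-- `A` and `B` are bi-embeddable. -/
def BiEmb (A B : EquivStruct) : Prop :=
  (∃ f, A.IsEmbedding B f) ∧ ∃ f, B.IsEmbedding A f

/-- The set of infinite equivalence classes of `A`. -/
def infClasses (A : EquivStruct) : Set (Set ℕ) :=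
  {c | c.Infinite ∧ ∃ x ∈ A.carrier, c = {y | A.rel x y}}

/-- The Turing degree of `g` computes embeddings between any two computable bi-embeddable copies
of `A`. (As `B` and `C` may be exchanged, this covers both directions. Universes of computable
structures are computable, so nothing is lost in taking `f` total on `ω`.) -/
def ComputesEmbeddings (A : EquivStruct) (g : ℕ → ℕ) : Prop :=
  ∀ B C : EquivStruct, B.IsComputable → C.IsComputable → B.BiEmb A → C.BiEmb A →
    ∃ f : ℕ → ℕ, B.IsEmbedding C f ∧ TuringReducible (f : ℕ →. ℕ) (g : ℕ →. ℕ)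

/-- The degree of bi-embeddable categoricity of `A` exists and is the Turing degree of `g`: it is
the least Turing degree that computes embeddings between any two computable bi-embeddable copies
of `A`. Turing degrees are represented by total functions. -/
def HasBiEmbDegree (A : EquivStruct) (g : ℕ → ℕ) : Prop :=
  A.ComputesEmbeddings g ∧
    ∀ h : ℕ → ℕ, A.ComputesEmbeddings h → TuringReducible (g : ℕ →. ℕ) (h : ℕ →. ℕ)

/-- `e` is an index of the equivalence structure `B`, that is, `B = 𝒞_e`: the universe of `B` is
`ω`, and `φ_e` is the (total) characteristic function of the equivalence relation of `B`. -/
def IsIndex (e : ℕ) (B : EquivStruct) : Prop :=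
  B.carrier = Set.univ ∧
    ∀ x y, (B.rel x y → 1 ∈ phi e (Nat.pair x y)) ∧ (¬ B.rel x y → 0 ∈ phi e (Nat.pair x y))

/-- The index set `{e : 𝒞_e is an equivalence structure bi-embeddable with A}`. -/
def biEmbIndexSet (A : EquivStruct) : Set ℕ :=
  {e | ∃ B : EquivStruct, IsIndex e B ∧ B.BiEmb A}

end EquivStruct

/-! Everything rests on one invariant. If there are exactly `k < ω` infinite classes and the finite
classes have unbounded size, then the bi-embeddable structures are those with the same two
properties (`EquivStruct.biEmb_iff`). An embedding carries the `k` infinite classes onto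
representatives of all infinite classes of the target, so finite classes go to finite ones.
Conversely, infinite classes can be matched and the finite ones sent to distinct, large enough
finite classes.

The hypothesis on the degree serves only to give unboundedness
(`EquivStruct.HasBiEmbDegree.unbFin`). If the finite classes were bounded, there would be a least
`s` such that only finitely many classes of the target have at least `s` elements. After finitely
much information is fixed, the remaining source classes have at most `s - 1` elements, and
infinitely many target classes have at least that many. A greedy search then yields a computable
embedding, and `0'` would be computable.

Upper bounds: being an equivalence structure is `Π⁰₂`, and having at least `k` infinite classes is
`Σ⁰₃`. Unboundedness is `Π⁰₂` relative to representatives of the infinite classes, because "finite"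
then means "different from those classes". Exactness subtracts a `Σ⁰₃` set; for `k = 0` no
representatives are needed, which leaves a `Π⁰₃` condition.

Hardness: a `Σ⁰₃` set has a computable predicate with exactly one infinite section at members and
none elsewhere (`IsSigma.exists_unique_infinite`). Sections become classes, beside fixed finite
blocks of unbounded size. For `X \ Y` the number of infinite classes is made `(k - 1) + [x ∈ X] + 2
[x ∈ Y]`, which equals `k` exactly on `X \ Y`. -/

section
-- Closure rules for computable functions
attribute [fun_prop] Computable
variable {α β γ σ : Type*} [Primcodable α] [Primcodable β] [Primcodable γ] [Primcodable σ]

@[fun_prop] theorem Computable.id_fun : Computable fun a : α => a := Computable.id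
attribute [fun_prop] Computable.const
@[fun_prop] theorem Computable.comp_fun {f : β → σ} {g : α → β} (hf : Computable f)
    (hg : Computable g) : Computable fun a => f (g a) := hf.comp hg
@[fun_prop] theorem Computable.pair_fun {f : α → β} {g : α → γ} (hf : Computable f)
    (hg : Computable g) : Computable fun a => (f a, g a) := hf.pair hg
@[fun_prop] theorem Computable.fst_fun {f : α → β × γ} (hf : Computable f) :
    Computable fun a => (f a).1 := Computable.fst.comp hf
@[fun_prop] theorem Computable.snd_fun {f : α → β × γ} (hf : Computable f) :
    Computable fun a => (f a).2 := Computable.snd.comp hf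
@[fun_prop] theorem Computable.natPair_fun {f g : α → ℕ} (hf : Computable f)
    (hg : Computable g) : Computable fun a => Nat.pair (f a) (g a) :=
  Primrec₂.natPair.to_comp.comp hf hg
@[fun_prop] theorem Computable.unpair_fun {f : α → ℕ} (hf : Computable f) :
    Computable fun a => Nat.unpair (f a) := Computable.unpair.comp hf
@[fun_prop] theorem Computable.and_fun {f g : α → Bool} (hf : Computable f)
    (hg : Computable g) : Computable fun a => f a && g a :=
  Primrec.and.to_comp.comp hf hg
@[fun_prop] theorem Computable.or_fun {f g : α → Bool} (hf : Computable f)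
    (hg : Computable g) : Computable fun a => f a || g a :=
  Primrec.or.to_comp.comp hf hg
@[fun_prop] theorem Computable.not_fun {f : α → Bool} (hf : Computable f) :
    Computable fun a => ! f a := Primrec.not.to_comp.comp hf
/-- Boolean equality test. -/
def eqB {β : Type*} [DecidableEq β] (x y : β) : Bool := decide (x = y)

@[simp] theorem eqB_eq_true {β : Type*} [DecidableEq β] {x y : β} : eqB x y = true ↔ x = y := decide_eq_true_iff

@[simp] theorem eqB_eq_false {β : Type*} [DecidableEq β] {x y : β} : eqB x y = false ↔ x ≠ y :=
  decide_eq_false_iff_not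

@[fun_prop] theorem Computable.eqB_fun [DecidableEq β] {f g : α → β}
    (hf : Computable f) (hg : Computable g) : Computable fun a => eqB (f a) (g a) :=
  Computable₂.comp Primrec.eq.decide.to_comp hf hg

/-- Boolean comparison of natural numbers. -/
def leB (m n : ℕ) : Bool := decide (m ≤ n)

@[simp] theorem leB_eq_true {m n : ℕ} : leB m n = true ↔ m ≤ n := decide_eq_true_iff

@[simp] theorem leB_eq_false {m n : ℕ} : leB m n = false ↔ ¬ m ≤ n := decide_eq_false_iff_not

@[fun_prop] theorem Computable.leB_fun {f g : α → ℕ} (hf : Computable f)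
    (hg : Computable g) : Computable fun a => leB (f a) (g a) :=
  Computable₂.comp Primrec.nat_le.decide.to_comp hf hg

/-- The number of `i < n` with `p i`. -/
def countLt (n : ℕ) (p : ℕ → Bool) : ℕ := Nat.count (fun i => p i = true) n

@[fun_prop] theorem Computable.countLt_fun {f : α → ℕ} {p : α → ℕ → Bool} (hf : Computable f)
    (hp : Computable fun q : α × ℕ => p q.1 q.2) : Computable fun a => countLt (f a) (p a) := by
  have h : Computable fun a => Nat.rec (motive := fun _ => ℕ) 0
      (fun i c => bif p a i then c + 1 else c) (f a) := by
    refine Computable.nat_rec hf (Computable.const 0) (h := fun a q => bif p a q.1 then q.2 + 1 else q.2) ?_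
    refine Computable.cond ?_ (Computable.succ.comp ?_) ?_ <;> fun_prop
  refine h.of_eq fun a => ?_
  unfold countLt
  induction f a with
  | zero => simp
  | succ n ih => cases hh : p a n <;> simp_all [Nat.count_succ]

/-- `p i` holds for all `i < n`. -/
def allLt (n : ℕ) (p : ℕ → Bool) : Bool := eqB (countLt n p) n

@[simp] theorem allLt_eq_true {n : ℕ} {p : ℕ → Bool} : allLt n p = true ↔ ∀ i < n, p i = true := by
  simp [allLt, countLt, Nat.count_iff_forall]

@[fun_prop] theorem Computable.allLt_fun {f : α → ℕ} {p : α → ℕ → Bool} (hf : Computable f)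
    (hp : Computable fun q : α × ℕ => p q.1 q.2) : Computable fun a => allLt (f a) (p a) := by
  unfold allLt; fun_prop

@[fun_prop] theorem Computable.add_fun {f g : α → ℕ} (hf : Computable f)
    (hg : Computable g) : Computable fun a => f a + g a :=
  Primrec.nat_add.to_comp.comp hf hg

@[fun_prop] theorem Computable.mul_fun {f g : α → ℕ} (hf : Computable f)
    (hg : Computable g) : Computable fun a => f a * g a :=
  Primrec.nat_mul.to_comp.comp hf hg

@[fun_prop] theorem Computable.div_fun {f g : α → ℕ} (hf : Computable f)
    (hg : Computable g) : Computable fun a => f a / g a :=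
  Primrec.nat_div.to_comp.comp hf hg

@[fun_prop] theorem Computable.sqrt_fun {f : α → ℕ} (hf : Computable f) :
    Computable fun a => Nat.sqrt (f a) :=
  Primrec.nat_sqrt.to_comp.comp hf

@[fun_prop] theorem Computable.mod_fun {f g : α → ℕ} (hf : Computable f)
    (hg : Computable g) : Computable fun a => f a % g a :=
  Primrec.nat_mod.to_comp.comp hf hg

@[fun_prop] theorem Computable.cond_fun {c : α → Bool} {f g : α → β} (hc : Computable c)
    (hf : Computable f) (hg : Computable g) : Computable fun a => bif c a then f a else g a :=
  Computable.cond hc hf hg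

@[fun_prop] theorem Computable.getD_fun {l : α → List β} {f : α → ℕ} (d : β) (hl : Computable l)
    (hf : Computable f) : Computable fun a => (l a).getD (f a) d :=
  (Primrec.list_getD d).to_comp.comp hl hf

@[fun_prop] theorem Computable.length_fun {l : α → List β} (hl : Computable l) :
    Computable fun a => (l a).length := Computable.list_length.comp hl

@[fun_prop] theorem Computable.append_fun {l m : α → List β} (hl : Computable l)
    (hm : Computable m) : Computable fun a => l a ++ m a := Computable.list_append.comp hl hm

@[fun_prop] theorem Computable.singleton_fun {f : α → β} (hf : Computable f) :
    Computable fun a => [f a] := Computable.list_cons.comp hf (Computable.const [])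

@[fun_prop] theorem Computable.ofNat_fun {δ : Type*} [Denumerable δ] {f : α → ℕ} (hf : Computable f) :
    Computable fun a => Denumerable.ofNat δ (f a) := (Computable.ofNat δ).comp hf

theorem computablePred_iff_bool {p : α → Prop} :
    ComputablePred p ↔ ∃ D : α → Bool, Computable D ∧ ∀ a, p a ↔ D a = true := by
  rw [ComputablePred.computable_iff]
  exact exists_congr fun D => and_congr_right fun _ => funext_iff.trans (by simp)

/-! ### Levels of the arithmetical hierarchy on arbitrary encodable types -/

/-- `Σ⁰₁` predicates. -/
def Sig1 (p : α → Prop) : Prop :=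
  ∃ D : α → ℕ → Bool, (Computable fun q : α × ℕ => D q.1 q.2) ∧ ∀ a, p a ↔ ∃ n, D a n = true

/-- `Π⁰₂` predicates. -/
def Pi2 (p : α → Prop) : Prop :=
  ∃ D : α → ℕ → ℕ → Bool, (Computable fun q : α × ℕ × ℕ => D q.1 q.2.1 q.2.2) ∧
    ∀ a, p a ↔ ∀ m, ∃ n, D a m n = true

theorem Sig1.of_bool {D : α → Bool} (h : Computable D) : Sig1 fun a => D a = true :=
  ⟨fun a _ => D a, by fun_prop, by simp⟩

theorem Sig1.comp {p : β → Prop} (hp : Sig1 p) {f : α → β} (hf : Computable f) :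
    Sig1 fun a => p (f a) := by
  obtain ⟨D, hD, h⟩ := hp
  exact ⟨fun a n => D (f a) n, by fun_prop, fun a => h _⟩

theorem Sig1.or {p q : α → Prop} (hp : Sig1 p) (hq : Sig1 q) : Sig1 fun a => p a ∨ q a := by
  obtain ⟨D, hD, h⟩ := hp
  obtain ⟨D', hD', h'⟩ := hq
  refine ⟨fun a n => D a n || D' a n, by fun_prop, fun a => ?_⟩
  simp [h, h', exists_or]

theorem Sig1.exists {p : α × ℕ → Prop} (hp : Sig1 p) : Sig1 fun a => ∃ n, p (a, n) := by
  obtain ⟨D, hD, h⟩ := hp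
  refine ⟨fun a n => D (a, n.unpair.1) n.unpair.2, by fun_prop, fun a => ?_⟩
  constructor
  · rintro ⟨n, hn⟩
    obtain ⟨m, hm⟩ := (h _).1 hn
    exact ⟨Nat.pair n m, by simpa using hm⟩
  · rintro ⟨n, hn⟩
    exact ⟨_, (h _).2 ⟨_, hn⟩⟩

theorem Sig1.pi2 {p : α → Prop} (hp : Sig1 p) : Pi2 p := by
  obtain ⟨D, hD, h⟩ := hp
  exact ⟨fun a _ n => D a n, by fun_prop, fun a => by simp [h]⟩

theorem Sig1.not_pi2 {p : α → Prop} (hp : Sig1 p) : Pi2 fun a => ¬ p a := by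
  obtain ⟨D, hD, h⟩ := hp
  exact ⟨fun a m _ => !D a m, by fun_prop, fun a => by simp [h]⟩

theorem Pi2.comp {p : β → Prop} (hp : Pi2 p) {f : α → β} (hf : Computable f) :
    Pi2 fun a => p (f a) := by
  obtain ⟨D, hD, h⟩ := hp
  exact ⟨fun a m n => D (f a) m n, by fun_prop, fun a => h _⟩

theorem Pi2.forall {p : α × ℕ → Prop} (hp : Pi2 p) : Pi2 fun a => ∀ n, p (a, n) := by
  obtain ⟨D, hD, h⟩ := hp
  refine ⟨fun a m n => D (a, m.unpair.1) m.unpair.2 n, by fun_prop, fun a => ?_⟩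
  constructor
  · intro H m
    exact (h _).1 (H m.unpair.1) m.unpair.2
  · intro H m
    refine (h _).2 fun n => ?_
    simpa using H (Nat.pair m n)

/-- The two universal variables are paired, hence vary independently: if both disjuncts fail, at `m`
and `m'`, then the matrix fails at their pair. -/
theorem Pi2.or {p q : α → Prop} (hp : Pi2 p) (hq : Pi2 q) : Pi2 fun a => p a ∨ q a := by
  obtain ⟨D, hD, h⟩ := hp
  obtain ⟨D', hD', h'⟩ := hq
  refine ⟨fun a m n => D a m.unpair.1 n || D' a m.unpair.2 n, by fun_prop, fun a => ?_⟩
  simp only [h, h']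
  constructor
  · rintro (H | H) m
    · obtain ⟨n, hn⟩ := H m.unpair.1
      exact ⟨n, by simp [hn]⟩
    · obtain ⟨n, hn⟩ := H m.unpair.2
      exact ⟨n, by simp [hn]⟩
  · intro H
    by_contra! hc
    obtain ⟨⟨m, hm⟩, m', hm'⟩ := hc
    obtain ⟨n, hn⟩ := H (Nat.pair m m')
    simp_all

theorem Pi2.and {p q : α → Prop} (hp : Pi2 p) (hq : Pi2 q) : Pi2 fun a => p a ∧ q a := by
  obtain ⟨D, hD, h⟩ := hp
  obtain ⟨D', hD', h'⟩ := hq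
  refine ⟨fun a m n => D a m n.unpair.1 && D' a m n.unpair.2, by fun_prop, fun a => ?_⟩
  simp only [h, h']
  rw [← forall_and]
  refine forall_congr' fun m => ?_
  constructor
  · rintro ⟨⟨n, hn⟩, n', hn'⟩
    exact ⟨Nat.pair n n', by simp [hn, hn']⟩
  · rintro ⟨n, hn⟩
    simp only [Bool.and_eq_true] at hn
    exact ⟨⟨_, hn.1⟩, _, hn.2⟩

theorem Pi2.of_eq {p q : α → Prop} (hp : Pi2 p) (h : ∀ a, p a ↔ q a) : Pi2 q := by
  obtain ⟨D, hD, h'⟩ := hp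
  exact ⟨D, hD, fun a => (h a).symm.trans (h' a)⟩

/-- Every `Π⁰₂` predicate has a `Σ⁰₂` complement, given by `Π⁰₂` instances. -/
theorem Pi2.exists_not {p : α → Prop} (hp : Pi2 p) :
    ∃ q : α × ℕ → Prop, Pi2 q ∧ ∀ a, ¬ p a ↔ ∃ n, q (a, n) := by
  obtain ⟨D, hD, h⟩ := hp
  refine ⟨fun q => ¬ ∃ n, D q.1 q.2 n = true,
    Sig1.not_pi2 (Sig1.exists (p := fun q : (α × ℕ) × ℕ => D q.1.1 q.1.2 q.2 = true)
      (Sig1.of_bool (by fun_prop))), fun a => ?_⟩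
  simp [h]

/-- The projections alternate with complements, so they unfold to `∃ ∀ ∃` over a decidable matrix;
the innermost complement turns into a Boolean negation. -/
theorem isSigma_three_iff {S : Set ℕ} :
    IsSigma 3 S ↔ ∃ p : ℕ × ℕ → Prop, Pi2 p ∧ ∀ x, x ∈ S ↔ ∃ y, p (x, y) := by
  constructor
  · rintro ⟨R, ⟨R2, ⟨R3, h3, hR3⟩, hR2⟩, hR⟩
    obtain ⟨D, hD, h⟩ := computablePred_iff_bool.1 (show ComputablePred fun x => x ∈ R3ᶜ from h3)
    refine ⟨fun q => Nat.pair q.1 q.2 ∈ R,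
      ⟨fun q m n => !D (Nat.pair (Nat.pair (Nat.pair q.1 q.2) m) n), by fun_prop, fun q => ?_⟩, hR⟩
    have e1 : ∀ z, z ∈ R ↔ ∀ m, Nat.pair z m ∈ R2ᶜ := fun z => by
      have := hR2 z
      simp only [Set.mem_compl_iff] at this ⊢
      rw [← not_iff_not, this]; simp
    simp only [e1]
    refine forall_congr' fun m => ?_
    rw [hR3]
    refine exists_congr fun n => ?_
    have := h (Nat.pair (Nat.pair (Nat.pair q.1 q.2) m) n)
    rw [Set.mem_compl_iff, not_iff_comm] at this
    rw [← this]; simp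
  · rintro ⟨p, ⟨D, hD, h⟩, hp⟩
    refine ⟨{z | p z.unpair}, ⟨{z | ¬ ∃ n, D z.unpair.1.unpair z.unpair.2 n = true},
      ⟨{z | D z.unpair.1.unpair.1.unpair z.unpair.1.unpair.2 z.unpair.2 = true}, ?_, ?_⟩, ?_⟩, ?_⟩
    · change ComputablePred _
      rw [computablePred_iff_bool]
      exact ⟨fun z => !D z.unpair.1.unpair.1.unpair z.unpair.1.unpair.2 z.unpair.2, by fun_prop,
        fun z => by simp⟩
    · simp
    · intro z
      simp [h]
    · simpa using hp
end

/-! ### Bi-embeddability in terms of infinite classes and sizes of finite classes -/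

namespace EquivStruct

variable {A B C : EquivStruct}

/-- The equivalence class of `x`. -/
def cls (A : EquivStruct) (x : ℕ) : Set ℕ := {y | A.rel x y}

/-- `r 0, …, r (k - 1)` lie in pairwise different infinite classes. -/
def InfIndep (A : EquivStruct) (k : ℕ) (r : ℕ → ℕ) : Prop :=
  ∀ i < k, r i ∈ A.carrier ∧ (A.cls (r i)).Infinite ∧ ∀ j < k, i ≠ j → ¬ A.rel (r i) (r j)

/-- There are at least `k` infinite classes. -/
def HasInf (A : EquivStruct) (k : ℕ) : Prop := ∃ r, A.InfIndep k r

/-- The finite classes have unbounded size. -/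
def UnbFin (A : EquivStruct) : Prop :=
  ∀ n, ∃ x ∈ A.carrier, (A.cls x).Finite ∧ n ≤ (A.cls x).ncard

theorem rel_comm {x y : ℕ} : A.rel x y ↔ A.rel y x := ⟨A.symm, A.symm⟩

theorem rel_congr_left {x y z : ℕ} (h : A.rel x y) : A.rel x z ↔ A.rel y z :=
  ⟨fun h' => A.trans (A.symm h) h', fun h' => A.trans h h'⟩

theorem rel_congr_right {x y z : ℕ} (h : A.rel x y) : A.rel z x ↔ A.rel z y :=
  ⟨fun h' => A.trans h' h, fun h' => A.trans h' (A.symm h)⟩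

theorem cls_eq {x y : ℕ} (h : A.rel x y) : A.cls x = A.cls y :=
  Set.ext fun _ => rel_congr_left h

theorem mem_cls_self {x : ℕ} (h : x ∈ A.carrier) : x ∈ A.cls x := A.refl h

theorem rel_of_cls_eq {x y : ℕ} (hy : y ∈ A.carrier) (h : A.cls x = A.cls y) : A.rel x y := by
  have : y ∈ A.cls x := h ▸ mem_cls_self hy
  exact this

theorem IsEmbedding.comp {f g : ℕ → ℕ} (hg : B.IsEmbedding C g) (hf : A.IsEmbedding B f) :
    A.IsEmbedding C (g ∘ f) :=
  ⟨hg.1.comp hf.1, hg.2.1.comp hf.2.1 hf.1, fun x hx y hy =>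
    (hf.2.2 x hx y hy).trans (hg.2.2 _ (hf.1 hx) _ (hf.1 hy))⟩

theorem IsEmbedding.encard_cls_le {f : ℕ → ℕ} (hf : A.IsEmbedding B f) {x : ℕ}
    (hx : x ∈ A.carrier) : (A.cls x).encard ≤ (B.cls (f x)).encard := by
  refine Set.encard_le_encard_of_injOn (f := f) (fun y hy => ?_) fun y hy z hz h => ?_
  · exact (hf.2.2 x hx y (A.mem_of_rel hy).2).1 hy
  · exact hf.2.1 (A.mem_of_rel hy).2 (A.mem_of_rel hz).2 h

theorem IsEmbedding.infinite_cls {f : ℕ → ℕ} (hf : A.IsEmbedding B f) {x : ℕ}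
    (hx : x ∈ A.carrier) (h : (A.cls x).Infinite) : (B.cls (f x)).Infinite := by
  have := hf.encard_cls_le hx
  rwa [h.encard_eq, top_le_iff, Set.encard_eq_top_iff] at this

theorem IsEmbedding.infIndep {f : ℕ → ℕ} (hf : A.IsEmbedding B f) {k : ℕ} {r : ℕ → ℕ}
    (h : A.InfIndep k r) : B.InfIndep k (f ∘ r) := fun i hi =>
  have H := h i hi
  ⟨hf.1 H.1, hf.infinite_cls H.1 H.2.1, fun j hj hij hr =>
    H.2.2 j hj hij ((hf.2.2 _ H.1 _ (h j hj).1).2 hr)⟩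

theorem InfIndep.succ {k : ℕ} {r : ℕ → ℕ} (h : A.InfIndep k r) {x : ℕ} (hx : x ∈ A.carrier)
    (hinf : (A.cls x).Infinite) (hr : ∀ i < k, ¬ A.rel x (r i)) :
    A.InfIndep (k + 1) (Function.update r k x) := by
  intro i hi
  rcases Nat.lt_succ_iff_lt_or_eq.1 hi with hi | rfl
  · rw [Function.update_of_ne hi.ne]
    refine ⟨(h i hi).1, (h i hi).2.1, fun j hj hij => ?_⟩
    rcases Nat.lt_succ_iff_lt_or_eq.1 hj with hj | rfl
    · rw [Function.update_of_ne hj.ne]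
      exact (h i hi).2.2 j hj hij
    · rw [Function.update_self]
      exact fun H => hr i hi (A.symm H)
  · rw [Function.update_self]
    refine ⟨hx, hinf, fun j hj hij => ?_⟩
    rw [Function.update_of_ne hij.symm]
    exact hr j (by omega)

/-- If there are exactly `k` infinite classes, `k` representatives exhaust them. -/
theorem InfIndep.exists_rel {k : ℕ} {r : ℕ → ℕ} (h : A.InfIndep k r) (hk : ¬ A.HasInf (k + 1))
    {x : ℕ} (hx : x ∈ A.carrier) (hinf : (A.cls x).Infinite) : ∃ i < k, A.rel x (r i) := by
  by_contra! hc
  exact hk ⟨_, h.succ hx hinf hc⟩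

theorem IsEmbedding.hasInf {f : ℕ → ℕ} (hf : A.IsEmbedding B f) {k : ℕ} (h : A.HasInf k) :
    B.HasInf k :=
  let ⟨_, hr⟩ := h; ⟨_, hf.infIndep hr⟩

/-- The images of the `k` infinite classes of `A` lie in `k` different infinite classes of `B`,
which are all there are. A finite class can therefore only go into a finite one, and that one is at
least as large. -/
theorem IsEmbedding.unbFin {f : ℕ → ℕ} (hf : A.IsEmbedding B f) {k : ℕ} (hA : A.HasInf k)
    (hB : ¬ B.HasInf (k + 1)) (h : A.UnbFin) : B.UnbFin := by
  intro n
  obtain ⟨r, hr⟩ := hA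
  obtain ⟨x, hx, hfin, hn⟩ := h n
  have hfin' : (B.cls (f x)).Finite := by
    by_contra hinf
    obtain ⟨i, hi, hrel⟩ := (hf.infIndep hr).exists_rel hB (hf.1 hx) hinf
    have := (hf.2.2 _ hx _ (hr i hi).1).2 hrel
    exact (hr i hi).2.1 (cls_eq this ▸ hfin)
  refine ⟨f x, hf.1 hx, hfin', hn.trans ?_⟩
  have := hf.encard_cls_le hx
  rwa [← hfin.cast_ncard_eq, ← hfin'.cast_ncard_eq, Nat.cast_le] at this

theorem le_encard_infClasses_iff {k : ℕ} : (k : ℕ∞) ≤ A.infClasses.encard ↔ A.HasInf k := by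
  constructor
  · intro h
    obtain ⟨t, ht, hk⟩ := Set.exists_subset_encard_eq h
    have hfin : t.Finite := Set.finite_of_encard_eq_coe hk
    obtain ⟨e, he, hinj⟩ : ∃ e : ℕ → Set ℕ, Set.MapsTo e (Set.Iio k) t ∧
        Set.InjOn e (Set.Iio k) := by
      obtain ⟨e, he, hinj⟩ := (Set.finite_Iio k).exists_injOn_of_encard_le (t := t) (by
        rw [hk]; rw [← Finset.coe_Iio, Set.encard_coe_eq_coe_finsetCard]; simp)
      exact ⟨e, fun i hi => he hi, hinj⟩
    have : ∀ i, ∃ x, i < k → x ∈ A.carrier ∧ e i = A.cls x := fun i => by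
      by_cases hi : i < k
      · obtain ⟨-, x, hx, hx'⟩ := ht (he hi)
        exact ⟨x, fun _ => ⟨hx, hx'⟩⟩
      · exact ⟨0, fun h => absurd h hi⟩
    choose r hr using this
    refine ⟨r, fun i hi => ⟨(hr i hi).1, (hr i hi).2 ▸ (ht (he hi)).1, fun j hj hij hrel => ?_⟩⟩
    apply hij
    apply hinj hi hj
    rw [(hr i hi).2, (hr j hj).2, cls_eq hrel]
  · rintro ⟨r, hr⟩
    have : (Set.Iio k).encard ≤ A.infClasses.encard := by
      refine Set.encard_le_encard_of_injOn (f := fun i => A.cls (r i)) (fun i hi => ?_) ?_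
      · exact ⟨(hr i hi).2.1, r i, (hr i hi).1, rfl⟩
      · intro i hi j hj h
        by_contra hij
        exact (hr i hi).2.2 j hj hij (rel_of_cls_eq (hr j hj).1 h)
    rw [← Finset.coe_Iio, Set.encard_coe_eq_coe_finsetCard] at this
    simpa using this

theorem encard_infClasses_eq_iff {k : ℕ} :
    A.infClasses.encard = k ↔ A.HasInf k ∧ ¬ A.HasInf (k + 1) := by
  rw [← le_encard_infClasses_iff, ← le_encard_infClasses_iff, not_le]
  push_cast
  rw [ENat.lt_add_one_iff (ENat.natCast_ne_top k), ← le_antisymm_iff, eq_comm]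

theorem exists_injOn_of_encard_le {s t : Set ℕ} (h : s.encard ≤ t.encard) :
    ∃ f : ℕ → ℕ, Set.MapsTo f s t ∧ Set.InjOn f s := by
  by_cases hs : s.Finite
  · obtain ⟨f, hf, hinj⟩ := hs.exists_injOn_of_encard_le h
    exact ⟨f, fun i hi => hf hi, hinj⟩
  · have ht : t.Infinite := by
      rw [Set.Infinite.encard_eq hs, top_le_iff, Set.encard_eq_top_iff] at h
      exact h
    exact ⟨Nat.nth (· ∈ t), fun i _ => Nat.nth_mem_of_infinite ht i,
      (Nat.nth_injective ht).injOn⟩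

/-- A map of classes that does not decrease their sizes is induced by an embedding. -/
theorem exists_isEmbedding_of_cls {G : ℕ → ℕ}
    (hrel : ∀ x ∈ A.carrier, ∀ y ∈ A.carrier, A.rel x y ↔ B.rel (G x) (G y))
    (hcard : ∀ x ∈ A.carrier, (A.cls x).encard ≤ (B.cls (G x)).encard) :
    ∃ f, A.IsEmbedding B f := by
  -- The injection is chosen as a function of the class itself, not of a representative, so that
  -- related elements use the same injection.
  have : ∀ c : Set ℕ, ∃ f : ℕ → ℕ, ∀ x ∈ A.carrier, c = A.cls x →
      (∀ y, A.rel x y → B.rel (G y) (f y)) ∧ Set.InjOn f (A.cls x) := fun c => by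
    by_cases hc : ∃ x ∈ A.carrier, c = A.cls x
    · obtain ⟨x, hx, rfl⟩ := hc
      obtain ⟨f, hf, hinj⟩ := exists_injOn_of_encard_le (hcard x hx)
      refine ⟨f, fun y hy hxy => ⟨fun z hz => ?_, hxy ▸ hinj⟩⟩
      have hz' : A.rel x z := by
        have : z ∈ A.cls x := hxy ▸ hz
        exact this
      have h1 : B.rel (G x) (f z) := hf hz'
      exact B.trans (B.symm ((hrel x hx z (A.mem_of_rel hz').2).1 hz')) h1
    · exact ⟨id, fun x hx h => absurd ⟨x, hx, h⟩ hc⟩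
  choose F hF using this
  have key : ∀ x ∈ A.carrier, B.rel (G x) (F (A.cls x) x) := fun x hx =>
    (hF _ x hx rfl).1 x (A.refl hx)
  have key2 : ∀ x ∈ A.carrier, ∀ y ∈ A.carrier,
      A.rel x y ↔ B.rel (F (A.cls x) x) (F (A.cls y) y) := fun x hx y hy => by
    rw [hrel x hx y hy, rel_congr_left (key x hx), rel_congr_right (key y hy)]
  refine ⟨fun x => F (A.cls x) x, fun x hx => (B.mem_of_rel (key x hx)).2, ?_, key2⟩
  intro x hx y hy hxy
  have hr : A.rel x y := (key2 x hx y hy).2 (by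
    simp only at hxy
    rw [← hxy]
    exact B.refl (B.mem_of_rel (key x hx)).2)
  simp only [cls_eq hr] at hxy
  exact (hF _ y hy rfl).2 (A.symm hr) (A.refl hy) hxy

/-- Each new class is chosen larger than the preceding one, so the sizes strictly increase and the
classes are different. -/
theorem UnbFin.exists_seq (h : B.UnbFin) (b : ℕ → ℕ) :
    ∃ H : ℕ → ℕ, (∀ n, H n ∈ B.carrier ∧ (B.cls (H n)).Finite ∧ b n ≤ (B.cls (H n)).ncard) ∧
      ∀ m n, B.rel (H m) (H n) → m = n := by
  choose u hu using h
  let N : ℕ → ℕ := fun n => Nat.rec (b 0) (fun n c => max (b (n + 1)) ((B.cls (u c)).ncard + 1)) n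
  have hN : ∀ n, N (n + 1) = max (b (n + 1)) ((B.cls (u (N n))).ncard + 1) := fun n => rfl
  have hmono : StrictMono fun n => (B.cls (u (N n))).ncard := by
    refine strictMono_nat_of_lt_succ fun n => ?_
    have := (hu (N (n + 1))).2.2
    have h2 := hN n
    change (B.cls (u (N n))).ncard < (B.cls (u (N (n + 1)))).ncard
    omega
  refine ⟨fun n => u (N n), fun n => ⟨(hu _).1, (hu _).2.1, le_trans ?_ (hu _).2.2⟩,
    fun m n hr => hmono.injective (by simp only [cls_eq hr])⟩
  cases n with
  | zero => exact le_rfl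
  | succ n => rw [hN]; exact le_max_left _ _

-- The class of `r i` goes to that of `s i`. A finite class is named by its least element `m` and
-- goes to the `m`-th term of a sequence of distinct finite classes, whose size is at least that of
-- the class of `m`.
open Classical in
theorem exists_isEmbedding_of_unbFin {k : ℕ} (hA : A.HasInf k) (hA' : ¬ A.HasInf (k + 1))
    (hB : B.HasInf k) (h : B.UnbFin) : ∃ f, A.IsEmbedding B f := by
  obtain ⟨r, hr⟩ := hA
  obtain ⟨s, hs⟩ := hB
  have hlt : ∀ x, x ∈ A.carrier → (A.cls x).Infinite → ∃ i < k, A.rel x (r i) := fun x hx hi =>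
    hr.exists_rel hA' hx hi
  obtain ⟨H, hH, hHinj⟩ := h.exists_seq fun n => (A.cls n).ncard
  let m : ℕ → ℕ := fun x => sInf (A.cls x)
  have hm : ∀ x ∈ A.carrier, A.rel x (m x) := fun x hx =>
    Nat.sInf_mem (s := A.cls x) ⟨x, A.refl hx⟩
  have hmeq : ∀ {x y}, A.rel x y → m x = m y := fun hxy => by
    simp only [m, cls_eq hxy]
  let ι : ℕ → ℕ := fun x => if hx : ∃ i < k, A.rel x (r i) then Nat.find hx else 0
  have hι : ∀ x, (∃ i < k, A.rel x (r i)) → ι x < k ∧ A.rel x (r (ι x)) := fun x hx => by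
    simp only [ι, dif_pos hx]
    exact Nat.find_spec hx
  let G : ℕ → ℕ := fun x => if ∃ i < k, A.rel x (r i) then s (ι x) else H (m x)
  have hGp : ∀ x, (∃ i < k, A.rel x (r i)) → G x = s (ι x) := fun x hx => if_pos hx
  have hGn : ∀ x, ¬ (∃ i < k, A.rel x (r i)) → G x = H (m x) := fun x hx => if_neg hx
  have hfin : ∀ x ∈ A.carrier, ¬ (∃ i < k, A.rel x (r i)) → (A.cls x).Finite := fun x hx h => by
    by_contra hc
    exact h (hlt x hx hc)
  have hG : ∀ x ∈ A.carrier, G x ∈ B.carrier := fun x hx => by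
    by_cases hc : ∃ i < k, A.rel x (r i)
    · rw [hGp x hc]; exact (hs _ (hι x hc).1).1
    · rw [hGn x hc]; exact (hH _).1
  refine exists_isEmbedding_of_cls (G := G) (fun x hx y hy => ⟨fun hxy => ?_, fun hxy => ?_⟩) fun x hx => ?_
  · have : G x = G y := by
      simp only [G, ι, rel_congr_left hxy, hmeq hxy]
    rw [this]
    exact B.refl (hG y hy)
  · by_cases hcx : ∃ i < k, A.rel x (r i) <;> by_cases hcy : ∃ i < k, A.rel y (r i)
    · rw [hGp x hcx, hGp y hcy] at hxy
      have : ι x = ι y := by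
        by_contra hne
        exact (hs _ (hι x hcx).1).2.2 _ (hι y hcy).1 hne hxy
      exact A.trans (hι x hcx).2 (this ▸ A.symm (hι y hcy).2)
    · rw [hGp x hcx, hGn y hcy] at hxy
      exact absurd (cls_eq hxy ▸ (hH _).2.1) (hs _ (hι x hcx).1).2.1
    · rw [hGn x hcx, hGp y hcy] at hxy
      exact absurd (cls_eq hxy ▸ (hH _).2.1) (hs _ (hι y hcy).1).2.1
    · rw [hGn x hcx, hGn y hcy] at hxy
      have := hHinj _ _ hxy
      exact A.trans (hm x hx) (this ▸ A.symm (hm y hy))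
  · by_cases hc : ∃ i < k, A.rel x (r i)
    · rw [hGp x hc, (hs _ (hι x hc).1).2.1.encard_eq]
      exact le_top
    · rw [hGn x hc, ← (hfin x hx hc).cast_ncard_eq, ← (hH _).2.1.cast_ncard_eq, Nat.cast_le,
        cls_eq (hm x hx)]
      exact (hH _).2.2

/-- Bi-embeddability with a structure with exactly `k` infinite classes and finite classes of
unbounded size. -/
theorem biEmb_iff {k : ℕ} (hA : A.HasInf k) (hA' : ¬ A.HasInf (k + 1)) (h : A.UnbFin) :
    B.BiEmb A ↔ B.HasInf k ∧ ¬ B.HasInf (k + 1) ∧ B.UnbFin := by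
  constructor
  · rintro ⟨⟨f, hf⟩, g, hg⟩
    have h2 : ¬ B.HasInf (k + 1) := fun hc => hA' (hf.hasInf hc)
    exact ⟨hg.hasInf hA, h2, hg.unbFin hA h2 h⟩
  · rintro ⟨h1, h2, h3⟩
    exact ⟨exists_isEmbedding_of_unbFin h1 h2 hA h, exists_isEmbedding_of_unbFin hA hA' h1 h3⟩

end EquivStruct

/-! ### Computable choice of successive values -/

section
variable {α : Type*} [Primcodable α]

@[fun_prop] theorem Computable.listAll_fun {ι : Type*} (l : List ι) {D : ι → α → Bool}
    (h : ∀ t, Computable (D t)) : Computable fun a => l.all fun t => D t a := by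
  induction l with
  | nil => simpa using Computable.const true
  | cons t l ih => simpa only [List.all_cons] using (h t).and_fun ih

@[fun_prop] theorem Computable.listAny_fun {ι : Type*} (l : List ι) {D : ι → α → Bool}
    (h : ∀ t, Computable (D t)) : Computable fun a => l.any fun t => D t a := by
  induction l with
  | nil => simpa using Computable.const false
  | cons t l ih => simpa only [List.any_cons] using (h t).or_fun ih

end

/-- Values can be chosen one after another in a computable way if the requirement on a value is
`Σ⁰₁` in the list of the earlier values, and can be met whenever it was met before. -/
theorem exists_computable_greedy {R : ℕ → (ℕ → ℕ) → ℕ → Prop}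
    (hloc : ∀ n g g' z, (∀ i < n, g i = g' i) → R n g z → R n g' z)
    (hsig : Sig1 fun q : List ℕ × ℕ => R q.1.length (fun i => q.1.getD i 0) q.2)
    (hex : ∀ n g, (∀ i < n, R i g (g i)) → ∃ z, R n g z) :
    ∃ f : ℕ → ℕ, Computable f ∧ ∀ n, R n f (f n) := by
  obtain ⟨D, hD, hDR⟩ := hsig
  -- The search runs over pairs of a value and a witness for its `Σ⁰₁` requirement, so it halts
  -- whenever an admissible value exists.
  let G : ℕ → List ℕ →. List ℕ := fun _ L =>
    (Nat.rfind fun c => Part.some (D (L, c.unpair.1) c.unpair.2)).map fun c => L ++ [c.unpair.1]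
  let F : ℕ →. List ℕ := fun n => Nat.rec (motive := fun _ => Part (List ℕ)) (Part.some [])
    (fun y IH => IH.bind fun L => G y L) n
  have hF : Partrec F := by
    refine Partrec.nat_rec (f := fun n => n) (g := fun _ => Part.some [])
      (h := fun _ q => G q.1 q.2) Computable.id (Computable.const []).partrec ?_
    refine Partrec.map (f := fun q : ℕ × ℕ × List ℕ => Nat.rfind fun c =>
      Part.some (D (q.2.2, c.unpair.1) c.unpair.2)) (g := fun q c => q.2.2 ++ [c.unpair.1]) ?_ ?_
    · refine Partrec.rfind ?_
      exact Computable.partrec (f := fun p : (ℕ × ℕ × List ℕ) × ℕ =>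
        D (p.1.2.2, p.2.unpair.1) p.2.unpair.2) (by fun_prop)
    · exact Computable₂.mk (by fun_prop)
  have key : ∀ n, ∃ L ∈ F n, L.length = n ∧
      ∀ i < n, R i (fun j => L.getD j 0) (L.getD i 0) := by
    intro n
    induction n with
    | zero => exact ⟨[], Part.mem_some _, rfl, by simp⟩
    | succ n ih =>
      obtain ⟨L, hL, hlen, hR⟩ := ih
      obtain ⟨z, hz⟩ := hex n _ hR
      obtain ⟨w, hw⟩ := (hDR (L, z)).1 (by simpa only [hlen] using hz)
      have hdom : ∃ c, c ∈ Nat.rfind fun c => Part.some (D (L, c.unpair.1) c.unpair.2) := by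
        obtain ⟨c, hc, -⟩ := Nat.rfind_min' (p := fun c => D (L, c.unpair.1) c.unpair.2)
          (m := Nat.pair z w) (by simpa using hw)
        exact ⟨c, hc⟩
      obtain ⟨c, hc⟩ := hdom
      have hc' : D (L, c.unpair.1) c.unpair.2 = true := (Part.mem_some_iff.1 (Nat.rfind_spec hc)).symm
      have hRc := (hDR (L, c.unpair.1)).2 ⟨_, hc'⟩
      simp only [hlen] at hRc
      have hagree : ∀ j < n, L.getD j 0 = (L ++ [c.unpair.1]).getD j 0 := fun j hj => by
        simp [List.getD, List.getElem?_append_left (hlen ▸ hj : j < L.length)]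
      refine ⟨L ++ [c.unpair.1], Part.mem_bind hL (Part.mem_map _ hc), by simp [hlen], ?_⟩
      intro i hi
      rcases Nat.lt_succ_iff_lt_or_eq.1 hi with hi | rfl
      · rw [← hagree i hi]
        exact hloc _ _ _ _ (fun j hj => hagree j (hj.trans hi)) (hR i hi)
      · have : (L ++ [c.unpair.1]).getD i 0 = c.unpair.1 := by
          simp [List.getD, ← hlen]
        rw [this]
        exact hloc _ _ _ _ hagree hRc
  choose L hL hlen hR using key
  have hLc : Computable L := hF.of_eq_tot hL
  have hext : ∀ n, ∀ j < n, (L (n + 1)).getD j 0 = (L n).getD j 0 := by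
    intro n j hj
    obtain ⟨L', hL', hm⟩ := Part.mem_bind_iff.1 (hL (n + 1))
    obtain ⟨c, hc, hc'⟩ := (Part.mem_map_iff _).1 hm
    have : L' = L n := Part.mem_unique hL' (hL n)
    subst this
    rw [← hc']
    simp [List.getD, List.getElem?_append_left ((hlen n).symm ▸ hj : j < (L n).length)]
  have hext' : ∀ n, ∀ j ≤ n, (L (n + 1)).getD j 0 = (L (j + 1)).getD j 0 := by
    intro n
    induction n with
    | zero => intro j hj; obtain rfl : j = 0 := by omega
              rfl
    | succ n ih =>
      intro j hj
      rcases hj.lt_or_eq with hj | rfl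
      · rw [hext (n + 1) j hj, ih j (by omega)]
      · rfl
  -- Entry `n` first appears in the list of length `n + 1` and never changes afterwards; locality
  -- transfers its requirement to the limit function.
  refine ⟨fun n => (L (n + 1)).getD n 0, by
    have : Computable fun n => L (n + 1) := hLc.comp Computable.succ
    fun_prop, fun n => ?_⟩
  exact hloc _ _ _ _ (fun i hi => hext' n i hi.le) (hR (n + 1) n (by omega))

/-! ### Computable embeddings when only finitely many classes are large -/

namespace EquivStruct

variable {A B C : EquivStruct}

/-- Finitely many classes contain all classes with at least `s` elements. -/
def FinBig (A : EquivStruct) (s : ℕ) : Prop :=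
  ∃ T : Set ℕ, T.Finite ∧ ∀ x ∈ A.carrier, (s : ℕ∞) ≤ (A.cls x).encard → ∃ t ∈ T, A.rel x t

/-- Large classes go into large ones. For each `t ∈ T` whose class is hit, one element sent into
that class represents all elements sent there. -/
theorem IsEmbedding.finBig {f : ℕ → ℕ} (hf : A.IsEmbedding B f) {s : ℕ} (h : B.FinBig s) :
    A.FinBig s := by
  obtain ⟨T, hT, h⟩ := h
  have : ∀ t, ∃ y, ∀ x ∈ A.carrier, B.rel (f x) t → y ∈ A.carrier ∧ B.rel (f y) t := fun t => by
    by_cases hc : ∃ x ∈ A.carrier, B.rel (f x) t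
    · exact ⟨hc.choose, fun _ _ _ => hc.choose_spec⟩
    · push Not at hc
      exact ⟨0, fun x hx hr => absurd hr (hc x hx)⟩
  choose p hp using this
  refine ⟨p '' T, hT.image p, fun x hx hs => ?_⟩
  obtain ⟨t, ht, hr⟩ := h (f x) (hf.1 hx) (hs.trans (hf.encard_cls_le hx))
  obtain ⟨h1, h2⟩ := hp t x hx hr
  exact ⟨p t, ⟨t, ht, rfl⟩, (hf.2.2 _ hx _ h1).2 (B.trans hr (B.symm h2))⟩

theorem exists_finBig {k : ℕ} (hk : A.HasInf k) (hk' : ¬ A.HasInf (k + 1)) (h : ¬ A.UnbFin) :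
    ∃ s, A.FinBig s := by
  obtain ⟨r, hr⟩ := hk
  unfold UnbFin at h
  push Not at h
  obtain ⟨n, hn⟩ := h
  refine ⟨n, r '' Set.Iio k, (Set.finite_Iio k).image r, fun x hx hs => ?_⟩
  have : (A.cls x).Infinite := fun hfin => by
    rw [← hfin.cast_ncard_eq, Nat.cast_le] at hs
    exact absurd (hn x hx hfin) (by omega)
  obtain ⟨i, hi, hrel⟩ := hr.exists_rel hk' hx this
  exact ⟨_, ⟨i, hi, rfl⟩, hrel⟩

/-- The requirement on the value at `n` of an embedding of `B` in `C` with earlier values `g`, which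
agrees with `f` on `T` and sends the classes that miss `T` to classes with at least `s` elements. -/
def Step (B C : EquivStruct) (T : List ℕ) (f : ℕ → ℕ) (s n : ℕ) (g : ℕ → ℕ) (z : ℕ) : Prop :=
  n ∈ B.carrier → (∀ t ∈ T, t = n → z = f t) ∧ ((∃ t ∈ T, t = n) ∨ (z ∈ C.carrier ∧
    (∀ t ∈ T, z ≠ f t ∧ (B.rel n t ↔ C.rel z (f t))) ∧
    (∀ i < n, i ∈ B.carrier → z ≠ g i ∧ (B.rel n i ↔ C.rel z (g i))) ∧
    ((∃ t ∈ T, B.rel n t) ∨ (s : ℕ∞) ≤ (C.cls z).encard)))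

theorem step_local {T : List ℕ} {f : ℕ → ℕ} {s n : ℕ} {g g' : ℕ → ℕ} {z : ℕ}
    (h : ∀ i < n, g i = g' i) (hs : Step B C T f s n g z) : Step B C T f s n g' z := by
  refine fun hn => ⟨(hs hn).1, (hs hn).2.imp_right fun H => ⟨H.1, H.2.1, fun i hi => ?_, H.2.2.2⟩⟩
  rw [← h i hi]
  exact H.2.2.1 i hi

theorem le_encard_iff_exists_countLt {c : ℕ → Bool} {s : ℕ} :
    (s : ℕ∞) ≤ {y | c y = true}.encard ↔ ∃ w, s ≤ countLt w c := by
  have hcount : ∀ w, countLt w c = {y | y < w ∧ c y = true}.ncard := fun w => by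
    rw [countLt, Nat.count_eq_card_filter_range, ← Set.ncard_coe_finset]
    simp
  constructor
  · intro h
    obtain ⟨t, ht, hk⟩ := Set.exists_subset_encard_eq h
    have hfin : t.Finite := Set.finite_of_encard_eq_coe hk
    obtain ⟨w, hw⟩ := hfin.bddAbove
    refine ⟨w + 1, ?_⟩
    rw [hcount]
    have h2 : t.ncard ≤ {y | y < w + 1 ∧ c y = true}.ncard :=
      Set.ncard_le_ncard (fun y hy => ⟨Nat.lt_succ_of_le (hw hy), ht hy⟩)
        ((Set.finite_Iio (w + 1)).subset fun y hy => hy.1)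
    rw [← hfin.cast_ncard_eq, Nat.cast_inj] at hk
    omega
  · rintro ⟨w, hw⟩
    rw [hcount] at hw
    calc (s : ℕ∞) ≤ ({y | y < w ∧ c y = true}.ncard : ℕ∞) := by exact_mod_cast hw
      _ = {y | y < w ∧ c y = true}.encard :=
        ((Set.finite_Iio w).subset fun y hy => hy.1).cast_ncard_eq
      _ ≤ _ := Set.encard_le_encard fun y hy => hy.2

/-- Although `f` need not be computable, only its finitely many values on `T` enter, and these are
constants. All clauses are then decidable except the lower bound on a class size, which is `Σ⁰₁`. -/
theorem step_sig1 (hB : B.IsComputable) (hC : C.IsComputable) (T : List ℕ) (f : ℕ → ℕ) (s : ℕ) :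
    Sig1 fun q : List ℕ × ℕ => Step B C T f s q.1.length (fun i => q.1.getD i 0) q.2 := by
  obtain ⟨b₀, hb₀, hb₀'⟩ := computablePred_iff_bool.1 hB.1
  obtain ⟨b, hb, hb'⟩ := computablePred_iff_bool.1 hB.2
  obtain ⟨c₀, hc₀, hc₀'⟩ := computablePred_iff_bool.1 hC.1
  obtain ⟨c, hc, hc'⟩ := computablePred_iff_bool.1 hC.2
  have hcls : ∀ z, C.cls z = {y | c (z, y) = true} := fun z => Set.ext fun y => hc' (z, y)
  let d : ℕ → List ℕ × ℕ → Bool := fun t q =>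
    !eqB q.2 (f t) && eqB (b (q.1.length, t)) (c (q.2, f t))
  let e : List ℕ × ℕ → ℕ → Bool := fun q i => !b₀ i || (!eqB q.2 (q.1.getD i 0) &&
    eqB (b (q.1.length, i)) (c (q.2, q.1.getD i 0)))
  have hd : ∀ t, Computable (d t) := fun t => by fun_prop
  have hd' : Computable fun q => T.all fun t => d t q := Computable.listAll_fun T hd
  have he : Computable fun p : (List ℕ × ℕ) × ℕ => e p.1 p.2 := by fun_prop
  have he' : Computable fun q : List ℕ × ℕ => allLt q.1.length (e q) :=
    Computable.allLt_fun (by fun_prop) he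
  have h1 : Computable fun q : List ℕ × ℕ => T.all fun t =>
      !eqB t q.1.length || eqB q.2 (f t) :=
    Computable.listAll_fun T fun t => by fun_prop
  have h2 : Computable fun q : List ℕ × ℕ => T.any fun t => eqB t q.1.length :=
    Computable.listAny_fun T fun t => by fun_prop
  have h3 : Computable fun q : List ℕ × ℕ => T.any fun t => b (q.1.length, t) :=
    Computable.listAny_fun T fun t => by fun_prop
  have h4 : Computable fun p : (List ℕ × ℕ) × ℕ =>
      leB s (countLt p.2 fun y => c (p.1.2, y)) := by fun_prop
  have h5 : Computable fun q : List ℕ × ℕ => c₀ q.2 && (T.all fun t => d t q) &&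
      allLt q.1.length (e q) :=
    ((hc₀.comp Computable.snd).and_fun hd').and_fun he'
  refine ⟨fun q w => !b₀ q.1.length || ((T.all fun t => !eqB t q.1.length ||
      eqB q.2 (f t)) && ((T.any fun t => eqB t q.1.length) || (c₀ q.2 &&
      (T.all fun t => d t q) && allLt q.1.length (e q) &&
      ((T.any fun t => b (q.1.length, t)) || leB s (countLt w fun y => c (q.2, y)))))),
    ?_, fun q => ?_⟩
  · refine Computable.or_fun (by fun_prop) (Computable.and_fun (h1.comp Computable.fst)
      (Computable.or_fun (h2.comp Computable.fst) (Computable.and_fun (h5.comp Computable.fst)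
        (Computable.or_fun (h3.comp Computable.fst) h4))))
  have e1 : ∀ x, x ∈ B.carrier ↔ b₀ x = true := hb₀'
  have e2 : ∀ x y, B.rel x y ↔ b (x, y) = true := fun x y => hb' (x, y)
  have e3 : ∀ x, x ∈ C.carrier ↔ c₀ x = true := hc₀'
  have e4 : ∀ x y, C.rel x y ↔ c (x, y) = true := fun x y => hc' (x, y)
  simp only [d, e, Step, hcls, le_encard_iff_exists_countLt, e1, e2, e3, e4, Bool.or_eq_true,
    Bool.and_eq_true, allLt_eq_true, List.all_eq_true, List.any_eq_true, leB_eq_true, eqB_eq_true, eqB_eq_false,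
    Bool.not_eq_true', exists_or, exists_and_left, exists_const,
    ← Bool.eq_iff_iff, ne_eq, imp_iff_not_or, Bool.not_eq_true, and_assoc]

/-- The earlier values form a partial embedding that is also coherent with `f` on `T`; this is the
invariant on which the next choice relies. -/
theorem step_spec {T : List ℕ} {f : ℕ → ℕ} {s n : ℕ} {g : ℕ → ℕ}
    (hf : B.IsEmbedding C f) (hT : ∀ t ∈ T, t ∈ B.carrier)
    (h : ∀ i < n, Step B C T f s i g (g i)) :
    (∀ i < n, i ∈ B.carrier → g i ∈ C.carrier ∧ ∀ t ∈ T, B.rel i t ↔ C.rel (g i) (f t)) ∧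
    ∀ i < n, i ∈ B.carrier → ∀ j < n, j ∈ B.carrier →
      (B.rel i j ↔ C.rel (g i) (g j)) ∧ (g i = g j → i = j) := by
  have h1 : ∀ i < n, i ∈ B.carrier →
      g i ∈ C.carrier ∧ ∀ t ∈ T, B.rel i t ↔ C.rel (g i) (f t) := fun i hi hiB => by
    obtain ⟨ha, ⟨t, ht, rfl⟩ | hb⟩ := h i hi hiB
    · rw [ha t ht rfl]
      exact ⟨hf.1 hiB, fun u hu => hf.2.2 _ hiB _ (hT u hu)⟩
    · exact ⟨hb.1, fun t ht => (hb.2.1 t ht).2⟩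
  have h2 : ∀ i < n, i ∈ B.carrier → ∀ j < i, j ∈ B.carrier →
      (B.rel i j ↔ C.rel (g i) (g j)) ∧ g i ≠ g j := fun i hi hiB j hj hjB => by
    obtain ⟨ha, ⟨t, ht, rfl⟩ | hb⟩ := h i hi hiB
    · rw [ha t ht rfl]
      refine ⟨?_, fun heq => ?_⟩
      · rw [rel_comm, C.rel_comm]
        exact (h1 j (hj.trans hi) hjB).2 t ht
      · obtain ⟨ha', ⟨u, hu, rfl⟩ | hb'⟩ := h j (hj.trans hi) hjB
        · rw [ha' u hu rfl] at heq
          exact hj.ne' (hf.2.1 hiB hjB heq)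
        · exact (hb'.2.1 t ht).1 heq.symm
    · exact (hb.2.2.1 j hj hjB).symm
  refine ⟨h1, fun i hi hiB j hj hjB => ?_⟩
  rcases lt_trichotomy i j with hij | rfl | hij
  · have := h2 j hj hjB i hij hiB
    exact ⟨by rw [rel_comm, C.rel_comm]; exact this.1, fun heq => absurd heq.symm this.2⟩
  · exact ⟨⟨fun _ => C.refl (h1 i hi hiB).1, fun _ => B.refl hiB⟩, fun _ => rfl⟩
  · have := h2 i hi hiB j hij hjB
    exact ⟨this.1, fun heq => absurd heq this.2⟩

/-- Outside `T` there are three cases. A class that meets `T` is infinite by `hinf`, so its image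
class has unused elements. A class missing `T` but already begun was sent to a class with at least
`s` elements, while it has at most `s` itself, so room remains. An entirely new class gets an
untouched target from `hnew`. -/
theorem exists_step {T : List ℕ} {f : ℕ → ℕ} {s n : ℕ} {g : ℕ → ℕ}
    (hf : B.IsEmbedding C f) (hT : ∀ t ∈ T, t ∈ B.carrier)
    (hinf : ∀ t ∈ T, ∀ y ∉ T, B.rel y t → (B.cls t).Infinite)
    (hsmall : ∀ y ∈ B.carrier, (∀ t ∈ T, ¬ B.rel y t) → (B.cls y).encard ≤ s)
    (hnew : ∀ y ∈ B.carrier, (∀ t ∈ T, ¬ B.rel y t) → ∀ F : Set ℕ, F.Finite →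
      ∃ z ∈ C.carrier, (s : ℕ∞) ≤ (C.cls z).encard ∧ ∀ w ∈ F, ¬ C.rel z w)
    (h : ∀ i < n, Step B C T f s i g (g i)) : ∃ z, Step B C T f s n g z := by
  by_cases hn : n ∈ B.carrier
  swap
  · exact ⟨0, fun h => absurd h hn⟩
  by_cases hnT : n ∈ T
  · exact ⟨f n, fun _ => ⟨fun t _ ht => by rw [ht], Or.inl ⟨n, hnT, rfl⟩⟩⟩
  obtain ⟨h1, h2⟩ := step_spec hf hT h
  suffices H : ∃ z ∈ C.carrier, (∀ t ∈ T, z ≠ f t ∧ (B.rel n t ↔ C.rel z (f t))) ∧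
      (∀ i < n, i ∈ B.carrier → z ≠ g i ∧ (B.rel n i ↔ C.rel z (g i))) ∧
      ((∃ t ∈ T, B.rel n t) ∨ (s : ℕ∞) ≤ (C.cls z).encard) by
    obtain ⟨z, hz⟩ := H
    exact ⟨z, fun _ => ⟨fun t ht htn => absurd (htn ▸ ht) hnT, Or.inr hz⟩⟩
  have hF : (f '' {t | t ∈ T} ∪ g '' Set.Iio n).Finite :=
    (T.finite_toSet.image f).union ((Set.finite_Iio n).image g)
  by_cases hc : ∃ t ∈ T, B.rel n t
  · obtain ⟨t, ht, hnt⟩ := hc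
    obtain ⟨z, hz, hzF⟩ := ((hf.infinite_cls (hT t ht) (hinf t ht n hnT hnt)).sdiff hF).nonempty
    have hz : C.rel (f t) z := hz
    refine ⟨z, (C.mem_of_rel hz).2, fun u hu => ⟨fun e => hzF (Or.inl ⟨u, hu, e.symm⟩), ?_⟩,
      fun i hi hiB => ⟨fun e => hzF (Or.inr ⟨i, hi, e.symm⟩), ?_⟩, Or.inl ⟨t, ht, hnt⟩⟩
    · rw [rel_congr_left hnt, ← C.rel_congr_left hz]
      exact hf.2.2 _ (hT t ht) _ (hT u hu)
    · rw [rel_congr_left hnt, ← C.rel_congr_left hz, rel_comm, C.rel_comm]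
      exact (h1 i hi hiB).2 t ht
  have hc' : ∀ t ∈ T, ¬ B.rel n t := fun t ht hr => hc ⟨t, ht, hr⟩
  by_cases hi : ∃ i < n, i ∈ B.carrier ∧ B.rel n i
  · obtain ⟨i, hi, hiB, hni⟩ := hi
    have hiT : ∀ t ∈ T, ¬ B.rel i t := fun t ht hr => hc' t ht (B.trans hni hr)
    have hsz : (s : ℕ∞) ≤ (C.cls (g i)).encard := by
      obtain ⟨-, ⟨t, ht, rfl⟩ | hb⟩ := h i hi hiB
      · exact absurd (B.refl hiB) (hiT t ht)
      · exact hb.2.2.2.resolve_left fun ⟨t, ht, hr⟩ => hiT t ht hr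
    have hSfin : {j | j < n ∧ B.rel n j}.Finite := (Set.finite_Iio n).subset fun j hj => hj.1
    -- The element `n` is not among its predecessors, which makes the count strict: used elements
    -- plus one is at most the class of `n`, hence at most `s`.
    have hlt : (g '' {j | j < n ∧ B.rel n j}).encard < (C.cls (g i)).encard := by
      have hle : {j | j < n ∧ B.rel n j}.encard + 1 ≤ (B.cls n).encard := by
        rw [← Set.encard_insert_of_notMem (a := n) (by simp)]
        exact Set.encard_le_encard
          (Set.insert_subset (B.refl hn) fun j hj => hj.2)
      refine (Set.encard_image_le _ _).trans_lt (lt_of_lt_of_le ?_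
        (hle.trans ((hsmall n hn hc').trans hsz)))
      exact ENat.lt_add_one_iff hSfin.encard_lt_top.ne |>.2 le_rfl
    obtain ⟨z, hz, hzS⟩ : ∃ z ∈ C.cls (g i), z ∉ g '' {j | j < n ∧ B.rel n j} := by
      by_contra! hcon
      exact absurd (Set.encard_le_encard hcon) (not_le.2 hlt)
    have hz : C.rel (g i) z := hz
    have hrj : ∀ j < n, j ∈ B.carrier → (B.rel n j ↔ C.rel z (g j)) := fun j hj hjB => by
      rw [rel_congr_left hni, ← C.rel_congr_left hz]
      exact (h2 i hi hiB j hj hjB).1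
    have hrt : ∀ t ∈ T, (B.rel n t ↔ C.rel z (f t)) := fun t ht => by
      rw [rel_congr_left hni, ← C.rel_congr_left hz]
      exact (h1 i hi hiB).2 t ht
    have hzz := C.refl (C.mem_of_rel hz).2
    refine ⟨z, (C.mem_of_rel hz).2, fun t ht => ⟨?_, hrt t ht⟩,
      fun j hj hjB => ⟨?_, hrj j hj hjB⟩, Or.inr (cls_eq hz ▸ hsz)⟩
    · intro e
      exact hc' t ht ((hrt t ht).2 (e ▸ hzz))
    · intro e
      exact hzS ⟨j, ⟨hj, (hrj j hj hjB).2 (e ▸ hzz)⟩, e.symm⟩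
  · push Not at hi
    obtain ⟨z, hz, hsz, hzF⟩ := hnew n hn hc' _ hF
    have hzz := C.refl hz
    refine ⟨z, hz, fun t ht => ?_, fun i hin hiB => ?_, Or.inr hsz⟩
    · have := hzF (f t) (Or.inl ⟨t, ht, rfl⟩)
      exact ⟨fun e => this (e ▸ hzz), iff_of_false (hc' t ht) this⟩
    · have := hzF (g i) (Or.inr ⟨i, hin, rfl⟩)
      exact ⟨fun e => this (e ▸ hzz), iff_of_false (hi i hin hiB) this⟩

/-- Let `s₁` be least with `C.FinBig s₁`. Pulling back along `f`, finitely many classes of `B`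
contain all those with at least `s₁` elements. The list `T` holds representatives of the infinite
ones and all elements of the finite ones. Classes that miss `T` have at most `s₁ - 1` elements, and
minimality of `s₁` always supplies a fresh class of `C` with at least `s₁ - 1`. -/
theorem exists_computable_isEmbedding (hB : B.IsComputable) (hC : C.IsComputable)
    {f : ℕ → ℕ} (hf : B.IsEmbedding C f) (hbig : ∃ s, C.FinBig s) :
    ∃ g, Computable g ∧ B.IsEmbedding C g := by
  classical
  obtain ⟨T₁, hT₁, h₁⟩ := hf.finBig (Nat.find_spec hbig)
  have hmin : ∀ s < Nat.find hbig, ¬ C.FinBig s := fun s hs => Nat.find_min hbig hs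
  generalize Nat.find hbig = s₁ at *
  have hTfin : ({t ∈ T₁ | (B.cls t).Infinite} ∪
      ⋃ t ∈ {t ∈ T₁ | (B.cls t).Finite}, B.cls t).Finite :=
    (hT₁.subset fun t ht => ht.1).union
      ((hT₁.subset fun t ht => ht.1).biUnion fun t ht => ht.2)
  obtain ⟨T, hT⟩ : ∃ T : List ℕ, ∀ t, t ∈ T ↔ (t ∈ T₁ ∧ (B.cls t).Infinite) ∨
      ∃ u ∈ T₁, (B.cls u).Finite ∧ B.rel u t :=
    ⟨hTfin.toFinset.toList, fun t => by
      simp only [Finset.mem_toList, Set.Finite.mem_toFinset, Set.mem_union, Set.mem_ofPred_eq,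
        Set.mem_iUnion, exists_prop, and_assoc]
      exact Iff.rfl⟩
  have hTB : ∀ t ∈ T, t ∈ B.carrier := fun t ht => by
    obtain ⟨-, hi⟩ | ⟨u, -, -, hr⟩ := (hT t).1 ht
    · obtain ⟨y, hy⟩ := hi.nonempty
      exact (B.mem_of_rel hy).1
    · exact (B.mem_of_rel hr).2
  have hlt : ∀ y ∈ B.carrier, (∀ t ∈ T, ¬ B.rel y t) → (B.cls y).encard < s₁ := fun y hy hyT => by
    by_contra! hle
    obtain ⟨t, ht, hr⟩ := h₁ y hy hle
    by_cases hfin : (B.cls t).Finite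
    · exact hyT t ((hT t).2 (Or.inr ⟨t, ht, hfin, B.refl (B.mem_of_rel hr).2⟩)) hr
    · exact hyT t ((hT t).2 (Or.inl ⟨ht, hfin⟩)) hr
  have hinf : ∀ t ∈ T, ∀ y ∉ T, B.rel y t → (B.cls t).Infinite := fun t ht y hy hr => by
    obtain ⟨-, hi⟩ | ⟨u, hu, hfin, hr'⟩ := (hT t).1 ht
    · exact hi
    · exact absurd ((hT y).2 (Or.inr ⟨u, hu, hfin, B.trans hr' (B.symm hr)⟩)) hy
  -- The subtraction `s₁ - 1` is truncated only for `s₁ = 0`, and then no class misses `T`.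
  have hpos : ∀ y ∈ B.carrier, (∀ t ∈ T, ¬ B.rel y t) → s₁ - 1 + 1 = s₁ := fun y hy hyT => by
    have := hlt y hy hyT
    rcases Nat.eq_zero_or_pos s₁ with rfl | h
    · simp at this
    · omega
  have hsmall : ∀ y ∈ B.carrier, (∀ t ∈ T, ¬ B.rel y t) → (B.cls y).encard ≤ (s₁ - 1 : ℕ) :=
    fun y hy hyT => by
      have := hlt y hy hyT
      rw [← hpos y hy hyT] at this
      exact Order.le_of_lt_add_one (by exact_mod_cast this)
  have hnew : ∀ y ∈ B.carrier, (∀ t ∈ T, ¬ B.rel y t) → ∀ F : Set ℕ, F.Finite →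
      ∃ z ∈ C.carrier, ((s₁ - 1 : ℕ) : ℕ∞) ≤ (C.cls z).encard ∧ ∀ w ∈ F, ¬ C.rel z w :=
    fun y hy hyT F hF => by
      by_contra! hcon
      exact hmin (s₁ - 1) (by have := hpos y hy hyT; omega) ⟨F, hF, hcon⟩
  obtain ⟨g, hg, hgs⟩ := exists_computable_greedy (R := Step B C T f (s₁ - 1))
    (fun n g g' z => step_local) (step_sig1 hB hC T f _)
    fun n g => exists_step hf hTB hinf hsmall hnew
  have hspec := fun n => step_spec (n := n) hf hTB fun i _ => hgs i
  refine ⟨g, hg, fun x hx => ((hspec (x + 1)).1 x (by omega) hx).1, fun x hx y hy => ?_,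
    fun x hx y hy => ?_⟩
  · exact ((hspec (x + y + 1)).2 x (by omega) hx y (by omega) hy).2
  · exact ((hspec (x + y + 1)).2 x (by omega) hx y (by omega) hy).1

end EquivStruct

/-- Composing `c` with the constant `0` gives a program that ignores its input, so it halts on its
own code exactly when `c` halts at `0`. -/
theorem not_computable_zeroJump : ¬ Computable zeroJump := by
  intro h
  open Nat.Partrec in
  refine ComputablePred.halting_problem 0 (computablePred_iff_bool.2
    ⟨fun c => eqB (zeroJump (Encodable.encode (Code.comp c (Code.const 0)))) 1, ?_, fun c => ?_⟩)
  · have : Computable fun c : Nat.Partrec.Code =>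
        Encodable.encode (Nat.Partrec.Code.comp c (Nat.Partrec.Code.const 0)) :=
      Computable.encode.comp
        (Nat.Partrec.Code.primrec₂_comp.to_comp.comp Computable.id (Computable.const _))
    fun_prop
  · have : (phi (Encodable.encode (c.comp (Nat.Partrec.Code.const 0)))
        (Encodable.encode (c.comp (Nat.Partrec.Code.const 0)))).Dom ↔ (c.eval 0).Dom := by
      rw [phi, Denumerable.ofNat_encode]
      simp only [Nat.Partrec.Code.eval, Nat.Partrec.Code.eval_const]
      change ((Part.some 0).bind c.eval).Dom ↔ _
      exact iff_of_eq (congrArg Part.Dom (Part.bind_some 0 c.eval))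
    by_cases hc : (c.eval 0).Dom <;> simp [zeroJump, this, hc]

/-- If the degree of bi-embeddable categoricity is `0'` and there are only finitely many infinite
classes, then the finite classes have unbounded size. -/
theorem EquivStruct.HasBiEmbDegree.unbFin {A : EquivStruct} (h : A.HasBiEmbDegree zeroJump)
    {k : ℕ} (hk : A.HasInf k) (hk' : ¬ A.HasInf (k + 1)) : A.UnbFin := by
  by_contra hU
  -- Bounded finite classes would let the least degree compute all the embeddings, contrary to the
  -- minimality of `0'`.
  have hA : A.ComputesEmbeddings fun _ => 0 := by
    rintro B C hB hC ⟨⟨f, hf⟩, -⟩ ⟨⟨f', hf'⟩, g', hg'⟩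
    obtain ⟨g, hg, hg'⟩ := exists_computable_isEmbedding hB hC (hg'.comp hf)
      ((exists_finBig hk hk' hU).imp fun s => hf'.finBig)
    exact ⟨g, hg', hg.partrec.turingReducible⟩
  exact not_computable_zeroJump (h.2 _ hA).partrec_of_const

/-! ### Upper bounds for index sets -/

section
variable {α : Type*} [Primcodable α]

theorem Sig1.and {p q : α → Prop} (hp : Sig1 p) (hq : Sig1 q) : Sig1 fun a => p a ∧ q a := by
  obtain ⟨D, hD, h⟩ := hp
  obtain ⟨D', hD', h'⟩ := hq
  refine ⟨fun a n => D a n.unpair.1 && D' a n.unpair.2, by fun_prop, fun a => ?_⟩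
  simp only [h, h', Bool.and_eq_true]
  constructor
  · rintro ⟨⟨n, hn⟩, m, hm⟩
    exact ⟨Nat.pair n m, by simpa using ⟨hn, hm⟩⟩
  · rintro ⟨n, hn⟩
    exact ⟨⟨_, hn.1⟩, _, hn.2⟩

/-- Finitely many witnesses have a common bound, so a single `m` with a bounded search below it
suffices. -/
theorem Sig1.forall_lt {p : α × ℕ → Prop} (hp : Sig1 p) {f : α → ℕ} (hf : Computable f) :
    Sig1 fun a => ∀ i < f a, p (a, i) := by
  obtain ⟨D, hD, h⟩ := hp
  refine ⟨fun a m => allLt (f a) fun i => !allLt m fun n => !D (a, i) n, by fun_prop, fun a => ?_⟩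
  simp only [h, allLt_eq_true, Bool.not_eq_true', ← Bool.not_eq_true, not_forall, not_not,
    exists_prop]
  constructor
  · intro H
    have : ∀ i, ∃ n, i < f a → D (a, i) n = true := fun i => by
      by_cases hi : i < f a
      · exact (H i hi).imp fun n hn _ => hn
      · exact ⟨0, fun h => absurd h hi⟩
    choose n hn using this
    refine ⟨(Finset.range (f a)).sup n + 1, fun i hi => ⟨n i, ?_, hn i hi⟩⟩
    exact Nat.lt_succ_of_le (Finset.le_sup (Finset.mem_range.2 hi))
  · rintro ⟨m, hm⟩ i hi
    obtain ⟨n, -, hn⟩ := hm i hi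
    exact ⟨n, hn⟩

/-- The `i`-th entry of the finite sequence with code `a`. -/
def seqEntry (a i : ℕ) : ℕ := (Denumerable.ofNat (List ℕ) a).getD i 0

@[fun_prop] theorem Computable.seqEntry_fun {f g : α → ℕ} (hf : Computable f)
    (hg : Computable g) : Computable fun a => seqEntry (f a) (g a) := by
  unfold seqEntry; fun_prop

theorem exists_seqEntry_eq (g : ℕ → ℕ) (n : ℕ) : ∃ a, ∀ i < n, seqEntry a i = g i :=
  ⟨Encodable.encode ((List.range n).map g), fun i hi => by
    simp [seqEntry, List.getD, List.getElem?_map, List.getElem?_range hi]⟩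

theorem le_encard_iff_exists_seqEntry {S : Set ℕ} {n : ℕ} : (n : ℕ∞) ≤ S.encard ↔
    ∃ a, ∀ i < n, seqEntry a i ∈ S ∧ ∀ j < i, seqEntry a j ≠ seqEntry a i := by
  have hcard : (Set.Iio n).encard = n := by
    rw [← Finset.coe_Iio, Set.encard_coe_eq_coe_finsetCard]; simp
  constructor
  · intro h
    obtain ⟨g, hg, hinj⟩ := (Set.finite_Iio n).exists_injOn_of_encard_le (hcard.trans_le h)
    obtain ⟨a, ha⟩ := exists_seqEntry_eq g n
    refine ⟨a, fun i hi => ⟨ha i hi ▸ hg hi, fun j hj e => hj.ne ?_⟩⟩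
    rw [ha i hi, ha j (hj.trans hi)] at e
    exact hinj (hj.trans hi) hi e
  · rintro ⟨a, ha⟩
    rw [← hcard]
    refine Set.encard_le_encard_of_injOn (f := seqEntry a) (fun i hi => (ha i hi).1) ?_
    intro i hi j hj e
    rcases lt_trichotomy i j with h | h | h
    · exact absurd e ((ha j hj).2 i h)
    · exact h
    · exact absurd e.symm ((ha i hi).2 j h)

theorem Sig1.le_encard {p : α × ℕ → Prop} (hp : Sig1 p) {f : α → ℕ} (hf : Computable f) :
    Sig1 fun a => (f a : ℕ∞) ≤ {y | p (a, y)}.encard := by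
  simp only [le_encard_iff_exists_seqEntry]
  refine Sig1.exists (p := fun q : α × ℕ => ∀ i < f q.1, p (q.1, seqEntry q.2 i) ∧
    ∀ j < i, seqEntry q.2 j ≠ seqEntry q.2 i)
    (Sig1.forall_lt (p := fun q : (α × ℕ) × ℕ => p (q.1.1, seqEntry q.1.2 q.2) ∧
      ∀ j < q.2, seqEntry q.1.2 j ≠ seqEntry q.1.2 q.2) ?_ (by fun_prop))
  refine (hp.comp (f := fun q : (α × ℕ) × ℕ => (q.1.1, seqEntry q.1.2 q.2)) (by fun_prop)).and ?_
  have := Sig1.of_bool (D := fun q : (α × ℕ) × ℕ => allLt q.2 fun j =>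
    !eqB (seqEntry q.1.2 j) (seqEntry q.1.2 q.2)) (by fun_prop)
  simpa using this

end

/-- The computation of `φ_e` at `n` yields `v` within `s` steps. -/
def phiB (e n v s : ℕ) : Bool :=
  eqB (Nat.Partrec.Code.evaln s (Denumerable.ofNat Nat.Partrec.Code e) n) (some v)

theorem mem_phi_iff {e n v : ℕ} : v ∈ phi e n ↔ ∃ s, phiB e n v s = true := by
  simp [phi, phiB, Nat.Partrec.Code.evaln_complete]

theorem sig1_mem_phi : Sig1 fun q : ℕ × ℕ × ℕ => q.2.2 ∈ phi q.1 q.2.1 := by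
  refine ⟨fun q s => phiB q.1 q.2.1 q.2.2 s, ?_, fun q => mem_phi_iff⟩
  have h : Computable fun p : (ℕ × ℕ × ℕ) × ℕ => Nat.Partrec.Code.evaln p.2
      (Denumerable.ofNat Nat.Partrec.Code p.1.1) p.1.2.1 :=
    Nat.Partrec.Code.primrec_evaln.to_comp.comp (f := fun q : (ℕ × Nat.Partrec.Code) × ℕ =>
      Nat.Partrec.Code.evaln q.1.1 q.1.2 q.2) (g := fun p : (ℕ × ℕ × ℕ) × ℕ =>
        ((p.2, Denumerable.ofNat Nat.Partrec.Code p.1.1), p.1.2.1)) (by fun_prop)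
  have h2 : Computable fun p : (ℕ × ℕ × ℕ) × ℕ => some p.1.2.2 :=
    Computable.option_some.comp (by fun_prop)
  exact Computable.eqB_fun h h2

theorem sig1_mem_phi_pair {α : Type*} [Primcodable α] {e x y : α → ℕ} (v : ℕ) (he : Computable e)
    (hx : Computable x) (hy : Computable y) :
    Sig1 fun a => v ∈ phi (e a) (Nat.pair (x a) (y a)) :=
  sig1_mem_phi.comp (f := fun a => (e a, Nat.pair (x a) (y a), v)) (by fun_prop)

/-! ### Quantifier complexity of conditions on indices -/

namespace EquivStruct

variable {A B : EquivStruct}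

/-- `φ_e` is the characteristic function of an equivalence relation. -/
def IsEqvIndex (e : ℕ) : Prop :=
  (∀ x y, 1 ∈ phi e (Nat.pair x y) ∨ 0 ∈ phi e (Nat.pair x y)) ∧
  (∀ x, 1 ∈ phi e (Nat.pair x x)) ∧
  (∀ x y, 0 ∈ phi e (Nat.pair x y) ∨ 1 ∈ phi e (Nat.pair y x)) ∧
  ∀ x y z, 0 ∈ phi e (Nat.pair x y) ∨ 0 ∈ phi e (Nat.pair y z) ∨ 1 ∈ phi e (Nat.pair x z)

theorem not_mem_phi_both {e n : ℕ} (h1 : 1 ∈ phi e n) (h0 : 0 ∈ phi e n) : False :=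
  absurd (Part.mem_unique h1 h0) one_ne_zero

theorem IsIndex.rel_iff {e : ℕ} (h : IsIndex e B) {x y : ℕ} :
    B.rel x y ↔ 1 ∈ phi e (Nat.pair x y) := by
  refine ⟨(h.2 x y).1, fun h1 => ?_⟩
  by_contra hc
  exact not_mem_phi_both h1 ((h.2 x y).2 hc)

theorem IsIndex.not_rel_iff {e : ℕ} (h : IsIndex e B) {x y : ℕ} :
    ¬ B.rel x y ↔ 0 ∈ phi e (Nat.pair x y) := by
  refine ⟨(h.2 x y).2, fun h0 hr => ?_⟩
  exact not_mem_phi_both ((h.2 x y).1 hr) h0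

theorem isEqvIndex_iff {e : ℕ} : IsEqvIndex e ↔ ∃ B, IsIndex e B := by
  constructor
  · rintro ⟨h1, h2, h3, h4⟩
    exact ⟨⟨Set.univ, fun x y => 1 ∈ phi e (Nat.pair x y), fun _ => ⟨trivial, trivial⟩,
      fun _ => h2 _, fun {x y} h => (h3 x y).resolve_left (not_mem_phi_both h),
      fun {x y z} h h' => ((h4 x y z).resolve_left (not_mem_phi_both h)).resolve_left
        (not_mem_phi_both h')⟩, rfl, fun x y => ⟨id, fun h => (h1 x y).resolve_left h⟩⟩
  · rintro ⟨B, h⟩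
    have hB : ∀ x, x ∈ B.carrier := fun x => h.1 ▸ trivial
    simp only [IsEqvIndex, ← h.rel_iff, ← h.not_rel_iff]
    refine ⟨fun x y => em _, fun x => B.refl (hB x), fun x y => ?_, fun x y z => ?_⟩
    · by_cases hr : B.rel x y
      · exact Or.inr (B.symm hr)
      · exact Or.inl hr
    · by_cases hr : B.rel x y
      · by_cases hr' : B.rel y z
        · exact Or.inr (Or.inr (B.trans hr hr'))
        · exact Or.inr (Or.inl hr')
      · exact Or.inl hr

/-- Non-equivalence is expressed by the value `0` instead of the absence of the value `1`; every
clause is thus `Σ⁰₁` behind universal quantifiers. -/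
theorem pi2_isEqvIndex : Pi2 IsEqvIndex := by
  have h2 : Pi2 fun e => ∀ x y, 1 ∈ phi e (Nat.pair x y) ∨ 0 ∈ phi e (Nat.pair x y) :=
    Pi2.forall (p := fun q : ℕ × ℕ => ∀ y, 1 ∈ phi q.1 (Nat.pair q.2 y) ∨
        0 ∈ phi q.1 (Nat.pair q.2 y))
      (Pi2.forall (p := fun q : (ℕ × ℕ) × ℕ => 1 ∈ phi q.1.1 (Nat.pair q.1.2 q.2) ∨
        0 ∈ phi q.1.1 (Nat.pair q.1.2 q.2))
        (Sig1.or (sig1_mem_phi_pair _ (by fun_prop) (by fun_prop) (by fun_prop))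
          (sig1_mem_phi_pair _ (by fun_prop) (by fun_prop) (by fun_prop))).pi2)
  have h1 : Pi2 fun e => ∀ x, 1 ∈ phi e (Nat.pair x x) :=
    Pi2.forall (p := fun q : ℕ × ℕ => 1 ∈ phi q.1 (Nat.pair q.2 q.2))
      (Sig1.pi2 (sig1_mem_phi_pair _ (by fun_prop) (by fun_prop) (by fun_prop)))
  have h3 : Pi2 fun e => ∀ x y, 0 ∈ phi e (Nat.pair x y) ∨ 1 ∈ phi e (Nat.pair y x) :=
    Pi2.forall (p := fun q : ℕ × ℕ => ∀ y, 0 ∈ phi q.1 (Nat.pair q.2 y) ∨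
        1 ∈ phi q.1 (Nat.pair y q.2))
      (Pi2.forall (p := fun q : (ℕ × ℕ) × ℕ => 0 ∈ phi q.1.1 (Nat.pair q.1.2 q.2) ∨
        1 ∈ phi q.1.1 (Nat.pair q.2 q.1.2))
        (Sig1.or (sig1_mem_phi_pair _ (by fun_prop) (by fun_prop) (by fun_prop))
          (sig1_mem_phi_pair _ (by fun_prop) (by fun_prop) (by fun_prop))).pi2)
  have h4 : Pi2 fun e => ∀ x y z, 0 ∈ phi e (Nat.pair x y) ∨ 0 ∈ phi e (Nat.pair y z) ∨
      1 ∈ phi e (Nat.pair x z) :=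
    Pi2.forall (p := fun q : ℕ × ℕ => ∀ y z, 0 ∈ phi q.1 (Nat.pair q.2 y) ∨
        0 ∈ phi q.1 (Nat.pair y z) ∨ 1 ∈ phi q.1 (Nat.pair q.2 z))
      (Pi2.forall (p := fun q : (ℕ × ℕ) × ℕ => ∀ z, 0 ∈ phi q.1.1 (Nat.pair q.1.2 q.2) ∨
        0 ∈ phi q.1.1 (Nat.pair q.2 z) ∨ 1 ∈ phi q.1.1 (Nat.pair q.1.2 z))
        (Pi2.forall (p := fun q : ((ℕ × ℕ) × ℕ) × ℕ =>
            0 ∈ phi q.1.1.1 (Nat.pair q.1.1.2 q.1.2) ∨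
            0 ∈ phi q.1.1.1 (Nat.pair q.1.2 q.2) ∨ 1 ∈ phi q.1.1.1 (Nat.pair q.1.1.2 q.2))
          (Sig1.or (sig1_mem_phi_pair _ (by fun_prop) (by fun_prop) (by fun_prop))
            (Sig1.or (sig1_mem_phi_pair _ (by fun_prop) (by fun_prop) (by fun_prop))
              (sig1_mem_phi_pair _ (by fun_prop) (by fun_prop) (by fun_prop)))).pi2))
  exact h2.and (h1.and (h3.and h4))

/-- The class of `x` in `𝒞_e` is infinite. -/
def InfAt (e x : ℕ) : Prop := ∀ m, ∃ y, m < y ∧ 1 ∈ phi e (Nat.pair x y)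

theorem IsIndex.infAt_iff {e : ℕ} (h : IsIndex e B) {x : ℕ} :
    InfAt e x ↔ (B.cls x).Infinite := by
  rw [Set.infinite_iff_exists_gt]
  refine forall_congr' fun m => exists_congr fun y => ?_
  rw [← h.rel_iff]
  exact and_comm

theorem pi2_infAt {α : Type*} [Primcodable α] {e x : α → ℕ} (he : Computable e)
    (hx : Computable x) : Pi2 fun a => InfAt (e a) (x a) :=
  Pi2.forall (p := fun q : α × ℕ => ∃ y, q.2 < y ∧ 1 ∈ phi (e q.1) (Nat.pair (x q.1) y))
    (Sig1.exists (p := fun q : (α × ℕ) × ℕ => q.1.2 < q.2 ∧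
      1 ∈ phi (e q.1.1) (Nat.pair (x q.1.1) q.2))
      (Sig1.and (by
        simpa using Sig1.of_bool (D := fun q : (α × ℕ) × ℕ => leB (q.1.2 + 1) q.2) (by fun_prop))
        (sig1_mem_phi_pair _ (by fun_prop) (by fun_prop) (by fun_prop)))).pi2

/-- The first `k` entries of the sequence with code `a` lie in different infinite classes of
`𝒞_e`. -/
def IndepAt (k e a : ℕ) : Prop :=
  (∀ i, k ≤ i ∨ InfAt e (seqEntry a i)) ∧
  ∀ i j, k ≤ i ∨ k ≤ j ∨ i = j ∨ 0 ∈ phi e (Nat.pair (seqEntry a i) (seqEntry a j))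

theorem IsIndex.indepAt_iff {e k a : ℕ} (h : IsIndex e B) :
    IndepAt k e a ↔ B.InfIndep k (seqEntry a) := by
  have hB : ∀ x, x ∈ B.carrier := fun x => h.1 ▸ trivial
  simp only [IndepAt, h.infAt_iff, ← h.not_rel_iff, InfIndep]
  constructor
  · rintro ⟨h1, h2⟩ i hi
    exact ⟨hB _, (h1 i).resolve_left (by omega), fun j hj hij =>
      (((h2 i j).resolve_left (by omega)).resolve_left (by omega)).resolve_left hij⟩
  · intro H
    refine ⟨fun i => ?_, fun i j => ?_⟩
    · rcases le_or_gt k i with hi | hi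
      · exact Or.inl hi
      · exact Or.inr (H i hi).2.1
    · rcases le_or_gt k i with hi | hi
      · exact Or.inl hi
      rcases le_or_gt k j with hj | hj
      · exact Or.inr (Or.inl hj)
      exact Or.inr (Or.inr (or_iff_not_imp_left.2 fun hij => (H i hi).2.2 j hj hij))

theorem InfIndep.congr {k : ℕ} {r r' : ℕ → ℕ} (h : A.InfIndep k r) (he : ∀ i < k, r' i = r i) :
    A.InfIndep k r' := fun i hi => by
  rw [he i hi]
  exact ⟨(h i hi).1, (h i hi).2.1, fun j hj => he j hj ▸ (h i hi).2.2 j hj⟩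

theorem IsIndex.hasInf_iff {e k : ℕ} (h : IsIndex e B) :
    B.HasInf k ↔ ∃ a, IndepAt k e a := by
  simp only [h.indepAt_iff]
  constructor
  · rintro ⟨r, hr⟩
    obtain ⟨a, ha⟩ := exists_seqEntry_eq r k
    exact ⟨a, hr.congr ha⟩
  · rintro ⟨a, ha⟩
    exact ⟨_, ha⟩

theorem pi2_indepAt (k : ℕ) : Pi2 fun q : ℕ × ℕ => IndepAt k q.1 q.2 := by
  refine Pi2.and ?_ ?_
  · refine Pi2.forall (p := fun q : (ℕ × ℕ) × ℕ => k ≤ q.2 ∨ InfAt q.1.1 (seqEntry q.1.2 q.2))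
      (Pi2.or ?_ (pi2_infAt (by fun_prop) (by fun_prop)))
    simpa using (Sig1.of_bool (D := fun q : (ℕ × ℕ) × ℕ => leB k q.2) (by fun_prop)).pi2
  · refine Pi2.forall (p := fun q : (ℕ × ℕ) × ℕ => ∀ j, k ≤ q.2 ∨ k ≤ j ∨ q.2 = j ∨ 0 ∈ phi q.1.1
      (Nat.pair (seqEntry q.1.2 q.2) (seqEntry q.1.2 j))) (Pi2.forall (p := fun q :
      ((ℕ × ℕ) × ℕ) × ℕ => k ≤ q.1.2 ∨ k ≤ q.2 ∨ q.1.2 = q.2 ∨ 0 ∈ phi q.1.1.1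
      (Nat.pair (seqEntry q.1.1.2 q.1.2) (seqEntry q.1.1.2 q.2))) ?_)
    refine Sig1.pi2 (Sig1.or ?_ (Sig1.or ?_ (Sig1.or ?_
      (sig1_mem_phi_pair _ (by fun_prop) (by fun_prop) (by fun_prop)))))
    · simpa using Sig1.of_bool (D := fun q : ((ℕ × ℕ) × ℕ) × ℕ => leB k q.1.2) (by fun_prop)
    · simpa using Sig1.of_bool (D := fun q : ((ℕ × ℕ) × ℕ) × ℕ => leB k q.2) (by fun_prop)
    · simpa using Sig1.of_bool (D := fun q : ((ℕ × ℕ) × ℕ) × ℕ => eqB q.1.2 q.2) (by fun_prop)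

/-- In `𝒞_e`, the classes that miss the first `k` entries of the sequence with code `a` have
unbounded size. -/
def UnbAt (k e a : ℕ) : Prop :=
  ∀ n : ℕ, ∃ x, (∀ i < k, 0 ∈ phi e (Nat.pair x (seqEntry a i))) ∧
    (n : ℕ∞) ≤ {y | 1 ∈ phi e (Nat.pair x y)}.encard

theorem pi2_unbAt (k : ℕ) : Pi2 fun q : ℕ × ℕ => UnbAt k q.1 q.2 :=
  Pi2.forall (p := fun q : (ℕ × ℕ) × ℕ => ∃ x, (∀ i < k, 0 ∈ phi q.1.1 (Nat.pair x
      (seqEntry q.1.2 i))) ∧ (q.2 : ℕ∞) ≤ {y | 1 ∈ phi q.1.1 (Nat.pair x y)}.encard)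
    (Sig1.exists (p := fun q : ((ℕ × ℕ) × ℕ) × ℕ => (∀ i < k, 0 ∈ phi q.1.1.1 (Nat.pair q.2
      (seqEntry q.1.1.2 i))) ∧ (q.1.2 : ℕ∞) ≤ {y | 1 ∈ phi q.1.1.1 (Nat.pair q.2 y)}.encard)
      (Sig1.and (Sig1.forall_lt (p := fun q : (((ℕ × ℕ) × ℕ) × ℕ) × ℕ => 0 ∈ phi q.1.1.1.1
          (Nat.pair q.1.2 (seqEntry q.1.1.1.2 q.2)))
          (sig1_mem_phi_pair _ (by fun_prop) (by fun_prop) (by fun_prop)) (f := fun _ => k)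
          (by fun_prop))
        (Sig1.le_encard (p := fun q : (((ℕ × ℕ) × ℕ) × ℕ) × ℕ => 1 ∈ phi q.1.1.1.1
          (Nat.pair q.1.2 q.2)) (sig1_mem_phi_pair _ (by fun_prop) (by fun_prop) (by fun_prop))
          (f := fun q => q.1.2) (by fun_prop)))).pi2

/-- Once all infinite classes are represented, a class is finite exactly when it misses the
representatives. This replaces finiteness by a `Σ⁰₁` condition. -/
theorem IsIndex.unbAt_iff {e k a : ℕ} (h : IsIndex e B) (ha : B.InfIndep k (seqEntry a))
    (hk : ¬ B.HasInf (k + 1)) : UnbAt k e a ↔ B.UnbFin := by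
  have hB : ∀ x, x ∈ B.carrier := fun x => h.1 ▸ trivial
  simp only [UnbAt, ← h.rel_iff, ← h.not_rel_iff]
  refine forall_congr' fun n => exists_congr fun x => ?_
  change _ ∧ _ ≤ (B.cls x).encard ↔ _
  have : (B.cls x).Finite ↔ ∀ i < k, ¬ B.rel x (seqEntry a i) := by
    refine ⟨fun hf i hi hr => (ha i hi).2.1 (cls_eq hr ▸ hf), fun hr => ?_⟩
    by_contra hinf
    obtain ⟨i, hi, hri⟩ := ha.exists_rel hk (hB x) hinf
    exact hr i hi hri
  rw [← this]
  constructor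
  · rintro ⟨hf, hn⟩
    rw [← hf.cast_ncard_eq, Nat.cast_le] at hn
    exact ⟨hB x, hf, hn⟩
  · rintro ⟨-, hf, hn⟩
    rw [← hf.cast_ncard_eq, Nat.cast_le]
    exact ⟨hf, hn⟩

theorem mem_biEmbIndexSet_iff {k : ℕ} (hA : A.HasInf k) (hA' : ¬ A.HasInf (k + 1)) (h : A.UnbFin)
    {e : ℕ} : e ∈ A.biEmbIndexSet ↔
      ∃ B, IsIndex e B ∧ B.HasInf k ∧ ¬ B.HasInf (k + 1) ∧ B.UnbFin := by
  simp only [biEmbIndexSet, Set.mem_ofPred_eq, biEmb_iff hA hA' h]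

/-- Unboundedness refers to the representatives, so it sits under the same existential quantifier as
they do. The subtracted set need not ask for an equivalence structure, since the first set already
does. -/
theorem isDSigma_biEmbIndexSet {k : ℕ} (hA : A.HasInf k) (hA' : ¬ A.HasInf (k + 1))
    (h : A.UnbFin) : IsDSigma 3 A.biEmbIndexSet := by
  refine ⟨{e | ∃ a, IsEqvIndex e ∧ IndepAt k e a ∧ UnbAt k e a},
    {e | ∃ a, IndepAt (k + 1) e a}, isSigma_three_iff.2 ⟨fun q => IsEqvIndex q.1 ∧ IndepAt k q.1 q.2 ∧ UnbAt k q.1 q.2, ?_,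
      fun x => Iff.rfl⟩,
    isSigma_three_iff.2 ⟨fun q => IndepAt (k + 1) q.1 q.2, pi2_indepAt (k + 1), fun x => Iff.rfl⟩, Set.ext fun e => ?_⟩
  · exact (pi2_isEqvIndex.comp Computable.fst).and ((pi2_indepAt k).and (pi2_unbAt k))
  rw [mem_biEmbIndexSet_iff hA hA' h]
  constructor
  · rintro ⟨B, hB, hk, hk', hU⟩
    obtain ⟨a, ha⟩ := hB.hasInf_iff.1 hk
    exact ⟨⟨a, isEqvIndex_iff.2 ⟨B, hB⟩, ha, (hB.unbAt_iff (hB.indepAt_iff.1 ha) hk').2 hU⟩,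
      fun hc => hk' (hB.hasInf_iff.2 hc)⟩
  · rintro ⟨⟨a, he, ha, hU⟩, hk'⟩
    obtain ⟨B, hB⟩ := isEqvIndex_iff.1 he
    have hk'' : ¬ B.HasInf (k + 1) := fun hc => hk' (hB.hasInf_iff.1 hc)
    exact ⟨B, hB, hB.hasInf_iff.2 ⟨a, ha⟩, hk'', (hB.unbAt_iff (hB.indepAt_iff.1 ha) hk'').1 hU⟩

/-- Without infinite classes the sequence of representatives is empty and any code, here `0`, will
do. No existential quantifier is left in the positive part. -/
theorem isPi_biEmbIndexSet (hA : ¬ A.HasInf 1) (h : A.UnbFin) : IsPi 3 A.biEmbIndexSet := by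
  have hz : ∀ B : EquivStruct, B.HasInf 0 := fun B => ⟨id, fun i hi => absurd hi (by omega)⟩
  obtain ⟨q, hq, hq'⟩ := (pi2_isEqvIndex.and ((pi2_unbAt 0).comp (f := fun e => (e, 0))
    (by fun_prop))).exists_not
  refine isSigma_three_iff.2 ⟨fun p => q p ∨ IndepAt 1 p.1 p.2, hq.or (pi2_indepAt 1), fun e => ?_⟩
  rw [exists_or, ← hq', Set.mem_compl_iff, mem_biEmbIndexSet_iff (hz A) hA h,
    ← not_iff_not, not_not, not_or, not_not]
  have hind : ∀ B : EquivStruct, B.InfIndep 0 (seqEntry 0) := fun B i hi => absurd hi (by omega)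
  constructor
  · rintro ⟨B, hB, -, hk', hU⟩
    exact ⟨⟨isEqvIndex_iff.2 ⟨B, hB⟩, (hB.unbAt_iff (hind B) hk').2 hU⟩,
      fun hc => hk' (hB.hasInf_iff.2 hc)⟩
  · rintro ⟨⟨he, hU⟩, hk'⟩
    obtain ⟨B, hB⟩ := isEqvIndex_iff.1 he
    have hk'' : ¬ B.HasInf 1 := fun hc => hk' (hB.hasInf_iff.1 hc)
    exact ⟨B, hB, hz B, hk'', (hB.unbAt_iff (hind B) hk'').1 hU⟩

end EquivStruct

/-! ### Hardness of index sets -/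

theorem Pi2.exists_infinite {α : Type*} [Primcodable α] {p : α → Prop} (hp : Pi2 p) :
    ∃ P : α × ℕ → Bool, Computable P ∧ ∀ a, p a ↔ {c | P (a, c) = true}.Infinite := by
  obtain ⟨D, hD, h⟩ := hp
  -- A pair `⟨m, s⟩` is counted when `s` is the least stage below which all `i ≤ m` have witnesses.
  -- Each `m` contributes at most one pair, so infinitely many pairs mean witnesses for every `i`.
  let ok : α → ℕ → ℕ → Bool := fun a m s => allLt (m + 1) fun i => !allLt s fun n => !D a i n
  have hok : ∀ {a m s}, ok a m s = true ↔ ∀ i ≤ m, ∃ n < s, D a i n = true := fun {a m s} => by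
    simp [ok, allLt_eq_true, ← Bool.not_eq_true]
  have hokc : Computable fun q : α × ℕ × ℕ => ok q.1 q.2.1 q.2.2 := by fun_prop
  refine ⟨fun q => ok q.1 q.2.unpair.1 q.2.unpair.2 &&
    allLt q.2.unpair.2 fun s => !ok q.1 q.2.unpair.1 s, ?_, fun a => ?_⟩
  · have h1 : Computable fun q : α × ℕ => ok q.1 q.2.unpair.1 q.2.unpair.2 :=
      hokc.comp (g := fun q : α × ℕ => (q.1, q.2.unpair.1, q.2.unpair.2)) (by fun_prop)
    have h2 : Computable fun q : (α × ℕ) × ℕ => ok q.1.1 q.1.2.unpair.1 q.2 :=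
      hokc.comp (g := fun q : (α × ℕ) × ℕ => (q.1.1, q.1.2.unpair.1, q.2)) (by fun_prop)
    exact h1.and_fun (Computable.allLt_fun (by fun_prop) h2.not_fun)
  · simp only [h, Bool.and_eq_true, allLt_eq_true, Bool.not_eq_true', ← Bool.not_eq_true]
    constructor
    · intro H
      have hex : ∀ m, ∃ s, ok a m s = true := fun m => by
        choose n hn using H
        exact ⟨(Finset.range (m + 1)).sup n + 1, hok.2 fun i hi => ⟨n i, Nat.lt_succ_of_le
          (Finset.le_sup (Finset.mem_range.2 (Nat.lt_succ_of_le hi))), hn i⟩⟩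
      refine Set.infinite_of_injective_forall_mem (f := fun m => Nat.pair m (Nat.find (hex m))) ?_ ?_
      · intro m m' hm
        exact (Nat.pair_eq_pair.1 hm).1
      · intro m
        simp only [Set.mem_ofPred_eq, Nat.unpair_pair]
        exact ⟨Nat.find_spec (hex m), fun s hs => Nat.find_min (hex m) hs⟩
    · intro H m
      have hinj : Set.InjOn (fun c => (Nat.unpair c).1) {c | ok a (Nat.unpair c).1 (Nat.unpair c).2 =
          true ∧ ∀ i < (Nat.unpair c).2, ¬ ok a (Nat.unpair c).1 i = true} := by
        intro c hc c' hc' e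
        simp only at e
        obtain ⟨h1, h2⟩ := hc
        obtain ⟨h1', h2'⟩ := hc'
        rw [e] at h1 h2
        have : (Nat.unpair c).2 = (Nat.unpair c').2 := by
          rcases lt_trichotomy (Nat.unpair c).2 (Nat.unpair c').2 with hl | hl | hl
          · exact absurd h1 (h2' _ hl)
          · exact hl
          · exact absurd h1' (h2 _ hl)
        rw [← Nat.pair_unpair c, ← Nat.pair_unpair c', e, this]
      obtain ⟨m', ⟨c, hc, rfl⟩, hm⟩ := (H.image hinj).exists_gt m
      obtain ⟨n, -, hn⟩ := hok.1 hc.1 m hm.le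
      exact ⟨n, hn⟩

/-- A `Σ⁰₃` set is given by a computable predicate whose infinite sections are unique. -/
theorem IsSigma.exists_unique_infinite {S : Set ℕ} (hS : IsSigma 3 S) :
    ∃ P : ℕ × ℕ × ℕ → Bool, Computable P ∧ ∀ x,
      {y | {c | P (x, y, c) = true}.Infinite}.Subsingleton ∧
      (x ∈ S ↔ {y | {c | P (x, y, c) = true}.Infinite}.Nonempty) := by
  obtain ⟨p, hp, hpS⟩ := isSigma_three_iff.1 hS
  obtain ⟨P₀, hP₀, hpP⟩ := hp.exists_infinite
  -- A witness is refined to a pair `⟨y, m⟩`: `y` is the least index of an infinite section, and `m`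
  -- the least bound for the elements of all smaller sections. `bd` says that `m` is a strict bound,
  -- `ex` that it cannot be lowered.
  let bd : ℕ → ℕ → ℕ → Prop := fun x y m => ∀ i < y, ∀ c, m ≤ c → P₀ ((x, i), c) = false
  let ex : ℕ → ℕ → ℕ → Prop := fun x y m => m = 0 ∨ ∃ i < y, P₀ ((x, i), m - 1) = true
  have hpred : Computable Nat.pred := Computable.pred
  -- `bd` is not decidable, so it is only tested below the current `c`; a violation cuts off the
  -- section from some point on and makes it finite.
  refine ⟨fun q => P₀ ((q.1, q.2.1.unpair.1), q.2.2) &&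
    (allLt q.2.1.unpair.1 fun i => allLt q.2.2 fun c =>
      !leB q.2.1.unpair.2 c || !P₀ ((q.1, i), c)) &&
    (eqB q.2.1.unpair.2 0 || !allLt q.2.1.unpair.1 fun i =>
      !P₀ ((q.1, i), Nat.pred q.2.1.unpair.2)), ?_, fun x => ?_⟩
  · have h1 : Computable fun q : ℕ × ℕ × ℕ => allLt q.2.1.unpair.1 fun i => allLt q.2.2 fun c =>
      !leB q.2.1.unpair.2 c || !P₀ ((q.1, i), c) := by fun_prop
    have h2 : Computable fun q : ℕ × ℕ × ℕ => (eqB q.2.1.unpair.2 0 ||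
      !allLt q.2.1.unpair.1 fun i => !P₀ ((q.1, i), Nat.pred q.2.1.unpair.2)) := by fun_prop
    have h3 : Computable fun q : ℕ × ℕ × ℕ => P₀ ((q.1, q.2.1.unpair.1), q.2.2) := by fun_prop
    exact (h3.and_fun h1).and_fun h2
  have key : ∀ z : ℕ, {c | (P₀ ((x, z.unpair.1), c) &&
      (allLt z.unpair.1 fun i => allLt c fun d =>
        !leB z.unpair.2 d || !P₀ ((x, i), d)) &&
      (eqB z.unpair.2 0 || !allLt z.unpair.1 fun i =>
        !P₀ ((x, i), Nat.pred z.unpair.2))) = true}.Infinite ↔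
      {c | P₀ ((x, z.unpair.1), c) = true}.Infinite ∧ bd x z.unpair.1 z.unpair.2 ∧
        ex x z.unpair.1 z.unpair.2 := by
    intro z
    simp only [Bool.and_eq_true, Bool.or_eq_true, allLt_eq_true, Bool.not_eq_true',
      leB_eq_false, eqB_eq_true, ← Bool.not_eq_true (allLt _ _), not_forall,
      exists_prop, Bool.not_eq_false]
    constructor
    · intro H
      obtain ⟨c₀, hc₀⟩ := H.nonempty
      refine ⟨H.mono fun c hc => hc.1.1, fun i hi c hc => ?_, hc₀.2⟩
      obtain ⟨d, hd, hcd⟩ := H.exists_gt c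
      exact (hd.1.2 i hi c hcd).resolve_left (not_not.2 hc)
    · rintro ⟨h1, h2, h3⟩
      refine h1.mono fun c hc => ⟨⟨hc, fun i hi d _ => ?_⟩, h3⟩
      exact or_iff_not_imp_left.2 fun hd => h2 i hi d (not_not.1 hd)
  simp only [key]
  constructor
  · have hlt : ∀ z w : ℕ, {c | P₀ ((x, z.unpair.1), c) = true}.Infinite →
        bd x w.unpair.1 w.unpair.2 → w.unpair.1 ≤ z.unpair.1 := fun z w hz hw => by
      by_contra! hc
      obtain ⟨d, hd, hcd⟩ := hz.exists_gt w.unpair.2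
      exact absurd hd (by simp [hw _ hc d hcd.le])
    have hle : ∀ y m m', bd x y m → ex x y m' → m' ≤ m := fun y m m' hb he => by
      by_contra! hc
      obtain he | ⟨i, hi, he⟩ := he
      · omega
      · rw [hb i hi _ (by omega)] at he
        exact absurd he (by simp)
    rintro z ⟨hz1, hz2, hz3⟩ w ⟨hw1, hw2, hw3⟩
    have e1 : z.unpair.1 = w.unpair.1 := le_antisymm (hlt w z hw1 hz2) (hlt z w hz1 hw2)
    have e2 : z.unpair.2 = w.unpair.2 :=
      le_antisymm (hle _ _ _ hw2 (e1 ▸ hz3)) (hle _ _ _ (e1 ▸ hz2) hw3)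
    rw [← Nat.pair_unpair z, ← Nat.pair_unpair w, e1, e2]
  · constructor
    · intro hx
      have hex : ∃ y, {c | P₀ ((x, y), c) = true}.Infinite :=
        ((hpS x).1 hx).imp fun y hy => (hpP _).1 hy
      classical
      obtain ⟨y, hy, hmin⟩ : ∃ y, {c | P₀ ((x, y), c) = true}.Infinite ∧
          ∀ i < y, {c | P₀ ((x, i), c) = true}.Finite :=
        ⟨Nat.find hex, Nat.find_spec hex, fun i hi => Set.not_infinite.1 (Nat.find_min hex hi)⟩
      have hb : ∃ m, bd x y m := by
        have hfin : (⋃ i ∈ Set.Iio y, {c | P₀ ((x, i), c) = true}).Finite :=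
          (Set.finite_Iio y).biUnion hmin
        obtain ⟨m, hm⟩ := hfin.bddAbove
        refine ⟨m + 1, fun i hi c hc => ?_⟩
        by_contra hcon
        have : c ≤ m := hm (Set.mem_biUnion (show i ∈ Set.Iio y from hi)
          (by simpa using hcon))
        omega
      refine ⟨Nat.pair y (Nat.find hb), ?_⟩
      simp only [Set.mem_ofPred_eq, Nat.unpair_pair]
      refine ⟨hy, Nat.find_spec hb, ?_⟩
      rcases Nat.eq_zero_or_pos (Nat.find hb) with h0 | h0
      · exact Or.inl h0
      · right
        have hn := Nat.find_min hb (Nat.sub_lt h0 one_pos)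
        simp only [bd, not_forall, Bool.not_eq_false] at hn
        obtain ⟨i, hi, c, hc, hP⟩ := hn
        have : c < Nat.find hb := by
          by_contra! hcon
          rw [Nat.find_spec hb i hi c hcon] at hP
          exact absurd hP (by simp)
        obtain rfl : c = Nat.find hb - 1 := by omega
        exact ⟨i, hi, hP⟩
    · rintro ⟨z, hz, -⟩
      exact (hpS x).2 ⟨_, (hpP _).2 hz⟩

/-! ### Coding sections of a computable predicate as equivalence classes -/

namespace EquivStruct

variable {A B C : EquivStruct}

/-- The equivalence structure on `ω` whose classes are the nonempty fibres of `h`. -/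
def ofInv (h : ℕ → ℕ) : EquivStruct where
  carrier := Set.univ
  rel u v := h u = h v
  mem_of_rel _ := ⟨trivial, trivial⟩
  refl _ := rfl
  symm := Eq.symm
  trans := Eq.trans

theorem IsIndex.unique {e : ℕ} (hB : IsIndex e B) (hC : IsIndex e C) : B = C := by
  have h1 : B.carrier = C.carrier := hB.1.trans hC.1.symm
  have h2 : B.rel = C.rel := funext fun x => funext fun y => propext (hB.rel_iff.trans hC.rel_iff.symm)
  cases B; cases C
  cases h1; cases h2
  rfl

/-- Currying a single program in its first argument produces the indices uniformly. -/
theorem exists_isIndex_ofInv {h : ℕ → ℕ → ℕ} (hh : Computable fun q : ℕ × ℕ => h q.1 q.2) :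
    ∃ g : ℕ → ℕ, Computable g ∧ ∀ x, IsIndex (g x) (ofInv (h x)) := by
  let F : ℕ → ℕ := fun q => bif eqB (h q.unpair.1 q.unpair.2.unpair.1)
    (h q.unpair.1 q.unpair.2.unpair.2) then 1 else 0
  have hF : Computable F := by fun_prop
  obtain ⟨c, hc⟩ := Nat.Partrec.Code.exists_code.1 (Partrec.nat_iff.1 hF)
  refine ⟨fun x => Encodable.encode (Nat.Partrec.Code.curry c x), Computable.encode.comp
    (Nat.Partrec.Code.primrec₂_curry.to_comp.comp (Computable.const c) Computable.id), fun x => ?_⟩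
  have hphi : ∀ u v, phi (Encodable.encode (Nat.Partrec.Code.curry c x)) (Nat.pair u v) =
      Part.some (F (Nat.pair x (Nat.pair u v))) := fun u v => by
    rw [phi, Denumerable.ofNat_encode, Nat.Partrec.Code.eval_curry, hc]
    rfl
  refine ⟨rfl, fun u v => ⟨fun hr => ?_, fun hr => ?_⟩⟩
  · have hr : h x u = h x v := hr
    have : eqB (h x u) (h x v) = true := eqB_eq_true.2 hr
    simp [hphi, F, this]
  · have hr : ¬ h x u = h x v := hr
    have : eqB (h x u) (h x v) = false := eqB_eq_false.2 hr
    simp [hphi, F, this]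

/-- The class of `u`: the even numbers form blocks of unbounded finite size, and an odd number
`2 ⟨y, c⟩ + 1` is put into the class with number `y` if `Q y c`, and into a class of its own
otherwise. -/
def inv (Q : ℕ × ℕ → Bool) (u : ℕ) : ℕ :=
  bif eqB (u % 2) 0 then 2 * Nat.sqrt (u / 2)
  else bif Q ((u / 2).unpair.1, (u / 2).unpair.2) then 4 * (u / 2).unpair.1 + 1
  else 4 * (u / 2) + 3

theorem inv_even (Q : ℕ × ℕ → Bool) {u : ℕ} (hu : u % 2 = 0) :
    inv Q u = 2 * Nat.sqrt (u / 2) := by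
  have : eqB (u % 2) 0 = true := eqB_eq_true.2 hu
  simp only [inv, this, cond_true]

theorem inv_odd_pos {Q : ℕ × ℕ → Bool} {u : ℕ} (hu : u % 2 = 1)
    (h : Q ((u / 2).unpair.1, (u / 2).unpair.2) = true) : inv Q u = 4 * (u / 2).unpair.1 + 1 := by
  have : eqB (u % 2) 0 = false := eqB_eq_false.2 (by omega)
  simp only [inv, this, h, cond_true, cond_false]

theorem inv_odd_neg {Q : ℕ × ℕ → Bool} {u : ℕ} (hu : u % 2 = 1)
    (h : Q ((u / 2).unpair.1, (u / 2).unpair.2) = false) : inv Q u = 4 * (u / 2) + 3 := by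
  have : eqB (u % 2) 0 = false := eqB_eq_false.2 (by omega)
  simp only [inv, this, h, cond_false]

/-- Even numbers get even labels, odd numbers get labels `1` or `3` modulo `4`, so blocks never
merge with other classes, and the square root has finite fibres. -/
theorem finite_inv_even (Q : ℕ × ℕ → Bool) (j : ℕ) : {u | inv Q u = 2 * j}.Finite := by
  refine (Set.finite_Iio (2 * ((j + 1) * (j + 1)))).subset fun u hu => ?_
  have hu : inv Q u = 2 * j := hu
  rcases Nat.mod_two_eq_zero_or_one u with h | h
  · rw [inv_even Q h] at hu
    have : Nat.sqrt (u / 2) < j + 1 := by omega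
    rw [Nat.sqrt_lt] at this
    simp only [Set.mem_Iio]
    omega
  · cases hq : Q ((u / 2).unpair.1, (u / 2).unpair.2)
    · rw [inv_odd_neg h hq] at hu; omega
    · rw [inv_odd_pos h hq] at hu; omega

theorem inv_eq_iff {Q : ℕ × ℕ → Bool} {u y : ℕ} :
    inv Q u = 4 * y + 1 ↔ ∃ c, Q (y, c) = true ∧ u = 2 * Nat.pair y c + 1 := by
  constructor
  · intro hu
    rcases Nat.mod_two_eq_zero_or_one u with h | h
    · rw [inv_even Q h] at hu; omega
    · cases hq : Q ((u / 2).unpair.1, (u / 2).unpair.2)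
      · rw [inv_odd_neg h hq] at hu; omega
      · rw [inv_odd_pos h hq] at hu
        obtain rfl : (u / 2).unpair.1 = y := by omega
        refine ⟨_, hq, ?_⟩
        rw [Nat.pair_unpair]
        omega
  · rintro ⟨c, hc, rfl⟩
    have h2 : (2 * Nat.pair y c + 1) / 2 = Nat.pair y c := by omega
    rw [inv_odd_pos (by omega) (by rw [h2]; simpa using hc), h2]
    simp

theorem infinite_inv_iff {Q : ℕ × ℕ → Bool} {y : ℕ} :
    {u | inv Q u = 4 * y + 1}.Infinite ↔ {c | Q (y, c) = true}.Infinite := by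
  have : {u | inv Q u = 4 * y + 1} = (fun c => 2 * Nat.pair y c + 1) '' {c | Q (y, c) = true} := by
    ext u
    simp only [Set.mem_ofPred_eq, inv_eq_iff, Set.mem_image, eq_comm]
  rw [this, Set.infinite_image_iff]
  intro c _ c' _ e
  have : Nat.pair y c = Nat.pair y c' := by
    simp only at e
    omega
  exact (Nat.pair_eq_pair.1 this).2

/-- Blocks and singletons are finite, so only labels `4 * y + 1` can be infinite classes. Different
`y` give different classes because these are nonempty. -/
theorem encard_infClasses_ofInv (Q : ℕ × ℕ → Bool) :
    (ofInv (inv Q)).infClasses.encard = {y | {c | Q (y, c) = true}.Infinite}.encard := by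
  have : (ofInv (inv Q)).infClasses =
      (fun y => {u | inv Q u = 4 * y + 1}) '' {y | {c | Q (y, c) = true}.Infinite} := by
    ext s
    constructor
    · rintro ⟨hs, u, -, rfl⟩
      have hs : {v | inv Q u = inv Q v}.Infinite := hs
      have hrw : ∀ w, inv Q u = w → {v | inv Q u = inv Q v} = {v | inv Q v = w} := fun w hw => by
        ext v; simp [hw, eq_comm]
      rcases Nat.mod_two_eq_zero_or_one u with h | h
      · rw [hrw _ (inv_even Q h)] at hs
        exact absurd (finite_inv_even Q _) hs
      · cases hq : Q ((u / 2).unpair.1, (u / 2).unpair.2)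
        · rw [hrw _ (inv_odd_neg h hq)] at hs
          refine absurd ((Set.finite_singleton u).subset fun v hv => ?_) hs
          have hv : inv Q v = 4 * (u / 2) + 3 := hv
          simp only [Set.mem_singleton_iff]
          rcases Nat.mod_two_eq_zero_or_one v with h' | h'
          · rw [inv_even Q h'] at hv; omega
          · cases hq' : Q ((v / 2).unpair.1, (v / 2).unpair.2)
            · rw [inv_odd_neg h' hq'] at hv; omega
            · rw [inv_odd_pos h' hq'] at hv; omega
        · rw [hrw _ (inv_odd_pos h hq)] at hs
          exact ⟨_, infinite_inv_iff.1 hs, (hrw _ (inv_odd_pos h hq)).symm⟩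
    · rintro ⟨y, hy, rfl⟩
      have hy' := infinite_inv_iff.2 hy
      obtain ⟨u, hu⟩ := hy'.nonempty
      refine ⟨hy', u, trivial, ?_⟩
      have hu : inv Q u = 4 * y + 1 := hu
      ext v
      change _ ↔ inv Q u = inv Q v
      rw [hu, eq_comm]
      rfl
  rw [this]
  refine Set.InjOn.encard_image fun y hy y' _ e => ?_
  obtain ⟨u, hu⟩ := (infinite_inv_iff.2 hy).nonempty
  have h1 : inv Q u = 4 * y + 1 := hu
  have h2 : u ∈ {u | inv Q u = 4 * y' + 1} := e ▸ hu
  have h2 : inv Q u = 4 * y' + 1 := h2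
  omega

/-- The numbers `n * n + i` with `i < n` all have square root `n`, so block `n` has at least `n`
elements. -/
theorem unbFin_ofInv (Q : ℕ × ℕ → Bool) : (ofInv (inv Q)).UnbFin := by
  intro n
  have hsq : ∀ i < n, inv Q (2 * (n * n + i)) = 2 * n := fun i hi => by
    rw [inv_even Q (by omega), Nat.mul_div_cancel_left _ two_pos, Nat.sqrt_add_eq n (by omega)]
  have hcls : (ofInv (inv Q)).cls (2 * (n * n)) = {u | inv Q u = 2 * n} := by
    ext v
    change inv Q _ = inv Q v ↔ inv Q v = 2 * n
    rw [inv_even Q (by omega), Nat.mul_div_cancel_left _ two_pos, Nat.sqrt_eq, eq_comm]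
  refine ⟨2 * (n * n), trivial, hcls ▸ finite_inv_even Q n, ?_⟩
  rw [hcls]
  have : ((fun i => 2 * (n * n + i)) '' Set.Iio n).ncard = n := by
    rw [Set.ncard_image_of_injective _ fun i j (e : 2 * (n * n + i) = 2 * (n * n + j)) => by omega,
      ← Finset.coe_Iio, Set.ncard_coe_finset, Nat.card_Iio]
  rw [← this]
  refine Set.ncard_le_ncard ?_ (by rw [this]; exact finite_inv_even Q n)
  rintro _ ⟨i, hi, rfl⟩
  rw [this]
  exact hsq i hi

/-- Counting infinite sections of a computable predicate reduces to the index set. -/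
theorem manyOneReducible_biEmbIndexSet {k : ℕ} (hA : A.HasInf k) (hA' : ¬ A.HasInf (k + 1))
    (h : A.UnbFin) {Q : ℕ × ℕ × ℕ → Bool} (hQ : Computable Q) :
    ManyOneReducible (fun x => {y | {c | Q (x, y, c) = true}.Infinite}.encard = k)
      (fun e => e ∈ A.biEmbIndexSet) := by
  obtain ⟨g, hg, hgB⟩ := exists_isIndex_ofInv (h := fun x => inv fun p => Q (x, p.1, p.2)) (by
    unfold inv; fun_prop)
  refine ⟨g, hg, fun x => ?_⟩
  change Set.encard {y | {c | Q (x, y, c) = true}.Infinite} = _ ↔ g x ∈ A.biEmbIndexSet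
  have hcard := encard_infClasses_ofInv fun p => Q (x, p.1, p.2)
  simp only at hcard
  rw [mem_biEmbIndexSet_iff hA hA' h, ← hcard, encard_infClasses_eq_iff]
  constructor
  · rintro ⟨h1, h2⟩
    exact ⟨_, hgB x, h1, h2, unbFin_ofInv _⟩
  · rintro ⟨B, hB, h1, h2, -⟩
    rw [hB.unique (hgB x)] at h1 h2
    exact ⟨h1, h2⟩

/-- The complement of `X` is `Σ⁰₃`, and its predicate has no infinite section exactly at the points
of `X`. -/
theorem manyOneReducible_of_isPi (hA : A.HasInf 0) (hA' : ¬ A.HasInf 1) (h : A.UnbFin)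
    {X : Set ℕ} (hX : IsPi 3 X) :
    ManyOneReducible (fun x => x ∈ X) (fun e => e ∈ A.biEmbIndexSet) := by
  obtain ⟨P, hP, hPX⟩ := IsSigma.exists_unique_infinite hX
  obtain ⟨g, hg, hg'⟩ := manyOneReducible_biEmbIndexSet hA hA' h hP
  refine ⟨g, hg, fun x => ?_⟩
  rw [← hg']
  change x ∈ X ↔ _ = ((0 : ℕ) : ℕ∞)
  rw [Nat.cast_zero, Set.encard_eq_zero, ← Set.not_nonempty_iff_eq_empty, ← (hPX x).2,
    Set.mem_compl_iff, not_not]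

theorem manyOneReducible_of_isDSigma {k : ℕ} (hk : 0 < k) (hA : A.HasInf k)
    (hA' : ¬ A.HasInf (k + 1)) (h : A.UnbFin) {S : Set ℕ} (hS : IsDSigma 3 S) :
    ManyOneReducible (fun x => x ∈ S) (fun e => e ∈ A.biEmbIndexSet) := by
  obtain ⟨X, Y, hX, hY, rfl⟩ := hS
  obtain ⟨P, hP, hPX⟩ := hX.exists_unique_infinite
  obtain ⟨R, hR, hRY⟩ := hY.exists_unique_infinite
  -- Four families of sections: `k - 1` that are always infinite (`z + 2 ≤ k` means `z < k - 1`),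
  -- one copy of the sections for `X`, and two copies of those for `Y`. With a single copy for `Y`,
  -- membership in `Y` alone would also give `k`.
  let Q : ℕ × ℕ × ℕ → Bool := fun q =>
    (eqB q.2.1.unpair.1 0 && leB (q.2.1.unpair.2 + 2) k) ||
    (eqB q.2.1.unpair.1 1 && P (q.1, q.2.1.unpair.2, q.2.2)) ||
    ((eqB q.2.1.unpair.1 2 || eqB q.2.1.unpair.1 3) && R (q.1, q.2.1.unpair.2, q.2.2))
  have hQ : Computable Q := by fun_prop
  obtain ⟨g, hg, hg'⟩ := manyOneReducible_biEmbIndexSet hA hA' h hQ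
  refine ⟨g, hg, fun x => ?_⟩
  rw [← hg']
  change x ∈ X \ Y ↔ Set.encard _ = _
  set U := {y | {c | P (x, y, c) = true}.Infinite} with hU
  set V := {y | {c | R (x, y, c) = true}.Infinite} with hV
  have hpair : ∀ i, Function.Injective (Nat.pair i) := fun i a b e => (Nat.pair_eq_pair.1 e).2
  have hdisj : ∀ {i j : ℕ} (s t : Set ℕ), i ≠ j → Disjoint (Nat.pair i '' s) (Nat.pair j '' t) := by
    intro i j s t hij
    rw [Set.disjoint_left]
    rintro _ ⟨a, -, rfl⟩ ⟨b, -, e⟩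
    exact hij (Nat.pair_eq_pair.1 e).1.symm
  have hset : {y | {c | Q (x, y, c) = true}.Infinite} = Nat.pair 0 '' Set.Iio (k - 1) ∪
      (Nat.pair 1 '' U ∪ (Nat.pair 2 '' V ∪ Nat.pair 3 '' V)) := by
    ext y
    obtain ⟨i, z, rfl⟩ : ∃ i z, y = Nat.pair i z := ⟨_, _, (Nat.pair_unpair y).symm⟩
    have himg : ∀ (j : ℕ) (s : Set ℕ), Nat.pair i z ∈ Nat.pair j '' s ↔ j = i ∧ z ∈ s :=
      fun j s => by
        simp only [Set.mem_image, Nat.pair_eq_pair]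
        constructor
        · rintro ⟨a, ha, rfl, rfl⟩
          exact ⟨rfl, ha⟩
        · rintro ⟨rfl, ha⟩
          exact ⟨z, ha, rfl, rfl⟩
    simp only [Set.mem_union, himg, Set.mem_ofPred_eq, Q, Nat.unpair_pair, Bool.or_eq_true,
      Bool.and_eq_true, eqB_eq_true, leB_eq_true, Set.mem_Iio]
    have hcst : ∀ q : Prop, {_c : ℕ | q}.Infinite ↔ q := fun q => by
      by_cases hq : q <;> simp [hq, Set.infinite_univ]
    rcases i with _ | _ | _ | _ | i
    · simp only [true_and, OfNat.zero_ne_ofNat, zero_ne_one, false_and, or_false,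
        OfNat.ofNat_ne_zero, one_ne_zero, hcst]
      omega
    · simp [hU]
    · simp [hV]
    · simp [hV]
    · constructor
      · intro hc
        obtain ⟨c, hc⟩ := hc.nonempty
        simp only [Set.mem_ofPred_eq] at hc
        omega
      · intro hc; omega
  have hcard : ∀ {T W : Set ℕ}, W.Subsingleton → (x ∈ T ↔ W.Nonempty) →
      (x ∈ T ∧ W.encard = 1) ∨ (x ∉ T ∧ W.encard = 0) := by
    intro T W hs hT
    rcases W.eq_empty_or_nonempty with h | h
    · exact Or.inr ⟨by rw [hT, h]; simp, by simp [h]⟩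
    · refine Or.inl ⟨hT.2 h, ?_⟩
      obtain ⟨w, hw⟩ := h
      rw [hs.eq_singleton_of_mem hw, Set.encard_singleton]
  have hIio : (Set.Iio (k - 1)).encard = (k - 1 : ℕ) := by
    rw [← Finset.coe_Iio, Set.encard_coe_eq_coe_finsetCard, Nat.card_Iio]
  rw [hset, Set.encard_union_eq, Set.encard_union_eq, Set.encard_union_eq (hdisj _ _ (by omega)),
    (hpair 0).encard_image, (hpair 1).encard_image, (hpair 2).encard_image,
    (hpair 3).encard_image, hIio]
  -- The four cases give `k`, `k - 1`, `k + 1` and `k + 2` infinite sections; `0 < k` keeps `k - 1`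
  -- different from `k`.
  · rcases hcard (hPX x).1 (hPX x).2 with ⟨hx, e⟩ | ⟨hx, e⟩ <;>
    rcases hcard (hRY x).1 (hRY x).2 with ⟨hy, e'⟩ | ⟨hy, e'⟩ <;>
    rw [e, e'] <;> simp only [Set.mem_sdiff, hx, hy] <;> norm_cast <;> simp <;> omega
  · exact Set.disjoint_union_right.2 ⟨hdisj _ _ (by omega), hdisj _ _ (by omega)⟩
  · exact Set.disjoint_union_right.2 ⟨hdisj _ _ (by omega),
      Set.disjoint_union_right.2 ⟨hdisj _ _ (by omega), hdisj _ _ (by omega)⟩⟩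

end EquivStruct

theorem mainTheorem11 (A : EquivStruct) (hA : A.IsComputable)
    (hdeg : A.HasBiEmbDegree zeroJump) :
    (A.infClasses = ∅ → IsCompleteFor (IsPi 3) A.biEmbIndexSet) ∧
    (∀ k : ℕ, 0 < k → A.infClasses.encard = k →
      IsCompleteFor (IsDSigma 3) A.biEmbIndexSet) := by
  constructor
  · intro h
    obtain ⟨h0, h1⟩ := EquivStruct.encard_infClasses_eq_iff.1
      (show A.infClasses.encard = (0 : ℕ) by simp [h])
    have hU := hdeg.unbFin h0 h1
    exact ⟨EquivStruct.isPi_biEmbIndexSet h1 hU,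
      fun X hX => EquivStruct.manyOneReducible_of_isPi h0 h1 hU hX⟩
  · intro k hk h
    obtain ⟨h0, h1⟩ := EquivStruct.encard_infClasses_eq_iff.1 h
    have hU := hdeg.unbFin h0 h1
    exact ⟨EquivStruct.isDSigma_biEmbIndexSet h0 h1 hU,
      fun X hX => EquivStruct.manyOneReducible_of_isDSigma hk h0 h1 hU hX⟩
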